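/- **Setting.** Let $\mathbf X$ and $\mathbf A$ be nonempty Borel subsets of complete separable metric spaces. Let $\phi:\mathbf X\times[0,\infty)\to\mathbf X$ be measurable with $\phi(x,0)=x$, $\phi(x,s+t)=\phi(\phi(x,s),t)$ and $\lim_{t\downarrow0}\phi(\phi(x,s),t)=\phi(x,s)$, let $l:\mathbf X\times\mathbf A\to\mathbf X$ be measurable, $\alpha\in(0,\infty)$, $J\ge 0$ an integer, $C^g_j:\mathbf X\to[0,\infty]$ and $C^I_j:\mathbf X\times\mathbf A\to[0,\infty]$ measurable for $j=0,\dots,J$, and $d_1,\dots,d_J\in[0,\infty)$. The induced MDP has state space $\mathbf X_\Delta=\mathbf X\cup\{\Delta\}$ with $\Delta$ an isolated point, action space $\mathbf B=[0,\infty]\times\mathbf A$ (with $[0,\infty]$ the one-point compactification of $[0,\infty)$), transition law $$Q(dy\mid x,(\theta,a))=e^{-\alpha\theta}\delta_{l(\phi(x,\theta),a)}(dy)+(1-e^{-\alpha\theta})\delta_\Delta(dy)\quad (x\in\mathbf X,\ \theta<\infty),\qquad Q(\cdot\mid x,(\theta,a))=\delta_\Delta\ \text{ otherwise},$$ and one-step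 costs $\bar C_j(\Delta,\cdot)=0$ and, for $x\in\mathbf X$, $$\bar C_j(x,(\theta,a))=\int_0^\theta e^{-\alpha t}C^g_j(\phi(x,t))\,dt+e^{-\alpha\theta}C^I_j(\phi(x,\theta),a),$$ where the last term is $0$ if $\theta=\infty$. A strategy $\pi=\{\pi_i\}_{i\ge1}$ is a sequence of stochastic kernels $\pi_i(db\mid h_{i-1})$ on $\mathbf B$ given the histories $h_{i-1}=(x_0,b_1,x_1,\dots,b_{i-1},x_{i-1})$. It is stationary if $\pi_i(db\mid h_{i-1})=\pi^s(db\mid x_{i-1})$ for one stochastic kernel $\pi^s$ and all $i$, and deterministic stationary if moreover $\pi^s(db\mid x)=\delta_{f(x)}(db)$ for a measurable $f:\mathbf X_\Delta\to\mathbf B$. Let $\mathsf E^\pi_x$ be the expectation for the process $X_0,B_1,X_1,B_2,\dots$ generated by $\pi$ and $Q$ from $X_0=x$. For a cost function $\bar C$ put $$\mathcal V(x,\pi,\bar C)=\mathsf E^\pi_x\Big[\sum_{i\ge1}\bar C(X_{i-1},B_i)\Big].$$ Fix $x_0\in\mathbf X$. The *constrained problem* is to minimize $\mathcal V(x_0,\pi,\bar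 C_0)$ over strategies $\pi$ subject to $\mathcal V(x_0,\pi,\bar C_j)\le d_j$, $j=1,\dots,J$. A strategy is feasible if it satisfies the constraints, and feasible with a finite value if also $\mathcal V(x_0,\pi,\bar C_0)<\infty$. The *occupation measure* of $\pi$ is $\mu^\pi(\Gamma)=\mathsf E^\pi_{x_0}\big[\sum_{i\ge0}\mathbb I\{(X_i,B_{i+1})\in\Gamma\}\big]$ on $\mathbf X_\Delta\times\mathbf B$. The induced MDP is *semicontinuous* if $\mathbf B$ is compact, $(x,b)\mapsto\int u(y)\,Q(dy\mid x,b)$ is continuous for every bounded continuous $u$ on $\mathbf X_\Delta$, and every $\bar C_j$ is lower semicontinuous. Put $\bar C=\sum_{j=0}^J\bar C_j$, $\mathcal V^*(x)=\inf_\pi\mathcal V(x,\pi,\bar C)$ and $\mathbf V=\{x\in\mathbf X_\Delta:\mathcal V^*(x)>0\}$, with complement $\mathbf V^c$ in $\mathbf X_\Delta$. Let $(\ast)$ be the following property of a measurable map $f:\mathbf X_\Delta\to\mathbf B$: the deterministic stationary strategy given by $f$ attains the infimum $\mathcal V^*(x)$ for every $x$, and $f(x)$ attains the infimum in the Bellman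 equation $\mathcal V^*(x)=\inf_{b\in\mathbf B}\{\bar C(x,b)+\int\mathcal V^*(y)Q(dy\mid x,b)\}$ for every $x$. Given $f^*$ with $(\ast)$, let $\Pi$ be the set of feasible strategies with a finite value such that $\pi_i(db\mid h_{i-1})=\delta_{f^*(x_{i-1})}(db)$ for all $i$ whenever $x_{i-1}\in\mathbf V^c$. The *relaxed problem* is to minimize $\int_{\mathbf V\times\mathbf B}\bar C_0\,d\mu$ over measures $\mu$ on $\mathbf V\times\mathbf B$ whose marginal on $\mathbf V$ is $\sigma$-finite, subject to $$\mu(\Gamma\times\mathbf B)=\delta_{x_0}(\Gamma)+\int_{\mathbf V\times\mathbf B}Q(\Gamma\mid y,b)\,\mu(dy\times db)\ \text{ for all Borel }\Gamma\subseteq\mathbf V,\qquad \int_{\mathbf V\times\mathbf B}\bar C_j\,d\mu\le d_j,\ j=1,\dots,J.$$ Given $f^*$, a stationary strategy $\pi^\mu$ is *induced* by a measure $\mu$ on $\mathbf V\times\mathbf B$ with $\sigma$-finite marginal on $\mathbf V$ if $\pi^\mu(db\mid x)=\varphi_\mu(db\mid x)$ for $x\in\mathbf V$ and $\pi^\mu(db\mid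 x)=\delta_{f^*(x)}(db)$ for $x\in\mathbf V^c$, where $\varphi_\mu$ is a stochastic kernel with $\varphi_\mu(db\mid x)\,\mu(dx\times\mathbf B)=\mu(dx\times db)$. **Theorem.** Suppose the induced MDP is semicontinuous and admits a feasible strategy with a finite value. Then a map $f^*$ with property $(\ast)$ exists, and: (a) the optimal values of the constrained problem and of the relaxed problem are equal and finite. Moreover, for every choice of $f^*$ with property $(\ast)$: (b) there is a strategy in $\Pi$ that is optimal in the constrained problem, and for every strategy $\pi^*\in\Pi$ that is optimal in the constrained problem, the restriction $\mu^{\pi^*}|_{\mathbf V\times\mathbf B}$ is optimal in the relaxed problem; (c) if $\mu^*$ is optimal in the relaxed problem, then $\mu^*$ induces at least one stationary strategy, and every stationary strategy $\pi^{\mu^*}$ induced by $\mu^*$ belongs to $\Pi$ and is optimal in the constrained problem. -/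

import Mathlib

open MeasureTheory ProbabilityTheory Filter Topology
open scoped NNReal ENNReal BoundedContinuousFunction

noncomputable section

namespace ImpulseControl

/-! ## Markov decision processes with total cost on Borel spaces -/

section MDP

variable {Y B : Type*} [MeasurableSpace Y] [MeasurableSpace B]

/-- The space of histories `(x₀, b₁, x₁, b₂, …, bₙ, xₙ)`: the first component lists the pairs
`(x₀, b₁), …, (xₙ₋₁, bₙ)` and the second one is the current state `xₙ`. -/
abbrev History (Y B : Type*) (n : ℕ) : Type _ := (Fin n → Y × B) × Y

/-- A (randomized, history-dependent) strategy: a sequence of stochastic kernels, `kernel n` being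
the conditional law of the action `b_{n+1}` given the history `(x₀, b₁, …, xₙ)`. -/
structure Strategy (Y B : Type*) [MeasurableSpace Y] [MeasurableSpace B] where
  kernel : (n : ℕ) → Kernel (History Y B n) B
  isMarkov : ∀ n, IsMarkovKernel (kernel n)

instance (π : Strategy Y B) (n : ℕ) : IsMarkovKernel (π.kernel n) := π.isMarkov n

/-- The stationary strategy given by a stochastic kernel `s` on the action space given the
state space. -/
def Strategy.stationary (s : Kernel Y B) [IsMarkovKernel s] : Strategy Y B where
  kernel n := s.comap (fun h : History Y B n => h.2) measurable_snd
  isMarkov _ := inferInstance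

/-- The deterministic stationary strategy given by a measurable map `f`. -/
def Strategy.detStationary (f : Y → B) (hf : Measurable f) : Strategy Y B :=
  Strategy.stationary (Kernel.deterministic f hf)

/-- The history `(x₀, b₁, …, xₙ, b_{n+1}, x)` made of the pairs `(xᵢ, b_{i+1})`, `i ≤ n`, and of the
next state `x`. -/
def extendHistory (n : ℕ) (p : ((_ : Finset.Iic n) → Y × B) × Y) : History Y B (n + 1) :=
  (fun k => p.1 ⟨k.1, Finset.mem_Iic.2 (Nat.lt_succ_iff.1 k.2)⟩, p.2)

lemma measurable_extendHistory (n : ℕ) :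
    Measurable (extendHistory n : ((_ : Finset.Iic n) → Y × B) × Y → History Y B (n + 1)) := by
  unfold extendHistory
  fun_prop

/-- The last pair `(xₙ, b_{n+1})` of a finite sequence of state-action pairs. -/
def lastPair (n : ℕ) (h : (_ : Finset.Iic n) → Y × B) : Y × B :=
  h ⟨n, Finset.mem_Iic.2 le_rfl⟩

lemma measurable_lastPair (n : ℕ) :
    Measurable (lastPair n : ((_ : Finset.Iic n) → Y × B) → Y × B) := by
  unfold lastPair
  fun_prop

/-- The conditional law of `(x_{n+1}, b_{n+2})` given `(x₀, b₁), …, (xₙ, b_{n+1})`: the state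
`x_{n+1}` is drawn from `Q(· | xₙ, b_{n+1})`, and then `b_{n+2}` is drawn from the strategy. -/
def stepKernel (Q : Kernel (Y × B) Y) (π : Strategy Y B) (n : ℕ) :
    Kernel ((_ : Finset.Iic n) → Y × B) (Y × B) :=
  (Q.comap (lastPair n) (measurable_lastPair n)) ⊗ₖ
    ((π.kernel (n + 1)).comap (extendHistory n) (measurable_extendHistory n))

instance (Q : Kernel (Y × B) Y) [IsMarkovKernel Q] (π : Strategy Y B) (n : ℕ) :
    IsMarkovKernel (stepKernel Q π n) := by
  unfold stepKernel
  infer_instance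

/-- The law of `(x₀, b₁)` when the initial state is `x`. -/
def initialLaw (π : Strategy Y B) (x : Y) : Measure (Y × B) :=
  (Measure.dirac x) ⊗ₘ
    ((π.kernel 0).comap (fun y : Y => ((Fin.elim0, y) : History Y B 0)) (by fun_prop))

/-- The strategic measure `P^π_x` on the canonical space `Ω = (Y × B)^ℕ`, whose elements are
`ω = ((x₀, b₁), (x₁, b₂), …)`, given by the Ionescu-Tulcea theorem. -/
def strategicMeasure (Q : Kernel (Y × B) Y) [IsMarkovKernel Q] (π : Strategy Y B) (x : Y) :
    Measure (ℕ → Y × B) :=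
  Kernel.trajMeasure (X := fun _ : ℕ => Y × B) (initialLaw π x) (stepKernel Q π)

/-- The performance measure `𝒱(x, π, C) = E^π_x [∑_{i ≥ 1} C(X_{i-1}, B_i)]`. -/
def value (Q : Kernel (Y × B) Y) [IsMarkovKernel Q] (C : Y × B → ℝ≥0∞) (x : Y)
    (π : Strategy Y B) : ℝ≥0∞ :=
  ∫⁻ ω, ∑' i : ℕ, C (ω i) ∂(strategicMeasure Q π x)

/-- The occupation measure `μ^π`, for the initial state `x`. -/
def occupation (Q : Kernel (Y × B) Y) [IsMarkovKernel Q] (x : Y) (π : Strategy Y B) :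
    Measure (Y × B) :=
  Measure.sum fun i : ℕ => (strategicMeasure Q π x).map fun ω => ω i

/-- The occupation measure of a set is the expected number of visits to it. -/
lemma occupation_apply (Q : Kernel (Y × B) Y) [IsMarkovKernel Q] (x : Y) (π : Strategy Y B)
    {Γ : Set (Y × B)} (hΓ : MeasurableSet Γ) :
    occupation Q x π Γ =
      ∫⁻ ω, ∑' i : ℕ, Γ.indicator (fun _ => (1 : ℝ≥0∞)) (ω i) ∂(strategicMeasure Q π x) := by
  have hm : ∀ i : ℕ, Measurable fun ω : ℕ → Y × B => Γ.indicator (fun _ => (1 : ℝ≥0∞)) (ω i) :=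
    fun i => (measurable_const.indicator hΓ).comp (measurable_pi_apply i)
  rw [lintegral_tsum fun i => (hm i).aemeasurable, occupation, Measure.sum_apply _ hΓ]
  refine tsum_congr fun i => ?_
  rw [Measure.map_apply (measurable_pi_apply i) hΓ,
    ← lintegral_indicator_one ((measurable_pi_apply i) hΓ)]
  rfl

/-- The Bellman function `𝒱*(x, C) = inf_π 𝒱(x, π, C)`. -/
def bellman (Q : Kernel (Y × B) Y) [IsMarkovKernel Q] (C : Y × B → ℝ≥0∞) (x : Y) : ℝ≥0∞ :=
  ⨅ π : Strategy Y B, value Q C x π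

/-- A semicontinuous MDP: the action space is compact, the transition law is weakly continuous and
all the cost functions are lower semicontinuous. -/
structure Semicontinuous [TopologicalSpace Y] [TopologicalSpace B] {ι : Type*}
    (Q : Kernel (Y × B) Y) (C : ι → Y × B → ℝ≥0∞) : Prop where
  compact : CompactSpace B
  continuous_transition : ∀ u : Y →ᵇ ℝ, Continuous fun z : Y × B => ∫ y, u y ∂(Q z)
  lsc_cost : ∀ j, LowerSemicontinuous (C j)

section Problems

variable {J : ℕ} (Q : Kernel (Y × B) Y) [IsMarkovKernel Q]
  (C : Fin (J + 1) → Y × B → ℝ≥0∞) (d : Fin J → ℝ≥0) (x₀ : Y)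

/-! ### The constrained problem
Minimize `𝒱(x₀, π, C₀)` over strategies `π`, subject to `𝒱(x₀, π, C_j) ≤ d_j`, `j = 1, …, J`. The
objective has index `0`, and the `j`-th constraint refers to the cost with index `j.succ`. -/

/-- The strategy satisfies all the constraints. -/
def Feasible (π : Strategy Y B) : Prop :=
  ∀ j : Fin J, value Q (C j.succ) x₀ π ≤ d j

/-- Feasible with a finite value. -/
def FeasibleFinite (π : Strategy Y B) : Prop :=
  Feasible Q C d x₀ π ∧ value Q (C 0) x₀ π < ∞

/-- Optimal in the constrained problem. -/
def Optimal (π : Strategy Y B) : Prop :=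
  Feasible Q C d x₀ π ∧
    ∀ π' : Strategy Y B, Feasible Q C d x₀ π' → value Q (C 0) x₀ π ≤ value Q (C 0) x₀ π'

/-- The optimal value of the constrained problem. -/
def optimalValue : ℝ≥0∞ :=
  ⨅ (π : Strategy Y B) (_ : Feasible Q C d x₀ π), value Q (C 0) x₀ π

/-- The sum `∑_{j=0}^J C_j` of all the cost functions. -/
def totalCost (z : Y × B) : ℝ≥0∞ := ∑ j, C j z

/-- The set `V` of the states at which the Bellman function of the sum of all the cost functions is
positive. -/
def posSet : Set Y := {x | 0 < bellman Q (totalCost C) x}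

/-- `f` is a deterministic stationary strategy that attains, at every state, both the infimum
defining the Bellman function of the total cost and the infimum in its Bellman equation. -/
structure IsSelector (f : Y → B) : Prop where
  measurable : Measurable f
  attains_value : ∀ x,
    value Q (totalCost C) x (Strategy.detStationary f measurable) = bellman Q (totalCost C) x
  bellman_eq : ∀ x, bellman Q (totalCost C) x =
    ⨅ b : B, (totalCost C (x, b) + ∫⁻ y, bellman Q (totalCost C) y ∂(Q (x, b)))
  attains_bellman : ∀ x,
    totalCost C (x, f x) + ∫⁻ y, bellman Q (totalCost C) y ∂(Q (x, f x)) =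
      ⨅ b : B, (totalCost C (x, b) + ∫⁻ y, bellman Q (totalCost C) y ∂(Q (x, b)))

/-- The class `Π` of the feasible strategies with a finite value that apply `f` whenever the current
state is outside `V`. -/
def InClassPi (f : Y → B) (π : Strategy Y B) : Prop :=
  FeasibleFinite Q C d x₀ π ∧
    ∀ (n : ℕ) (h : History Y B n), h.2 ∉ posSet Q C → π.kernel n h = Measure.dirac (f h.2)

/-! ### The relaxed problem, over measures on `V × B` -/

/-- The value of the `j`-th linear functional, `∫_{V × B} C_j dμ`. -/
def relaxedCost (j : Fin (J + 1)) (μ : Measure (posSet Q C × B)) : ℝ≥0∞ :=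
  ∫⁻ z, C j (z.1.1, z.2) ∂μ

/-- Feasibility in the relaxed problem. The value `δ_{x₀}(Γ)` for `Γ ⊆ V` is computed in `Y`, so that
it makes sense without assuming `x₀ ∈ V`. -/
structure RelaxedFeasible (μ : Measure (posSet Q C × B)) : Prop where
  sigmaFinite : SigmaFinite μ.fst
  characteristic : ∀ Γ : Set (posSet Q C), MeasurableSet Γ →
    μ (Γ ×ˢ Set.univ) =
      Measure.dirac x₀ (Subtype.val '' Γ) + ∫⁻ z, Q (z.1.1, z.2) (Subtype.val '' Γ) ∂μ
  constraint : ∀ j : Fin J, relaxedCost Q C j.succ μ ≤ d j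

/-- Optimality in the relaxed problem. -/
def RelaxedOptimal (μ : Measure (posSet Q C × B)) : Prop :=
  RelaxedFeasible Q C d x₀ μ ∧
    ∀ μ', RelaxedFeasible Q C d x₀ μ' → relaxedCost Q C 0 μ ≤ relaxedCost Q C 0 μ'

/-- The optimal value of the relaxed problem. -/
def relaxedValue : ℝ≥0∞ :=
  ⨅ (μ : Measure (posSet Q C × B)) (_ : RelaxedFeasible Q C d x₀ μ), relaxedCost Q C 0 μ

/-- The restriction of a measure on `Y × B` to `V × B`, as a measure on `V × B`. -/
def restrictV (ν : Measure (Y × B)) : Measure (posSet Q C × B) :=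
  ν.comap (Prod.map Subtype.val id)

/-- The stationary strategy `s` is induced by the measure `μ` on `V × B`: on `V` it is a stochastic
kernel `φ` with `φ(db|x) μ(dx × B) = μ(dx × db)`, and outside `V` it applies `f`. -/
def IsInduced (f : Y → B) (μ : Measure (posSet Q C × B)) (s : Kernel Y B) : Prop :=
  ∃ φ : Kernel (posSet Q C) B, IsMarkovKernel φ ∧ μ.fst ⊗ₘ φ = μ ∧
    (∀ x : posSet Q C, s x = φ x) ∧ ∀ x, x ∉ posSet Q C → s x = Measure.dirac (f x)

end Problems

end MDP

/-! ## The impulse control model and the MDP it induces -/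

/-- A discounted impulse control model with state space `X`, impulse space `A` and `J` constraints:
a semiflow, the effect of impulses, a discount factor, cost rates, impulse costs and the
constraint constants. -/
structure Model (X A : Type*) [TopologicalSpace X] [MeasurableSpace X] [MeasurableSpace A]
    (J : ℕ) where
  flow : X → ℝ≥0 → X
  flow_zero : ∀ x, flow x 0 = x
  measurable_flow : Measurable fun p : X × ℝ≥0 => flow p.1 p.2
  flow_right_continuous : ∀ x s, Tendsto (fun t => flow (flow x s) t) (𝓝[>] 0) (𝓝 (flow x s))
  flow_add : ∀ x s t, flow x (s + t) = flow (flow x s) t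
  jump : X × A → X
  measurable_jump : Measurable jump
  α : ℝ
  α_pos : 0 < α
  costRate : Fin (J + 1) → X → ℝ≥0∞
  measurable_costRate : ∀ j, Measurable (costRate j)
  impulseCost : Fin (J + 1) → X × A → ℝ≥0∞
  measurable_impulseCost : ∀ j, Measurable (impulseCost j)
  d : Fin J → ℝ≥0

/-- The state space `X ∪ {Δ}`, where `Δ = Sum.inr ()` is an isolated point. -/
abbrev StateΔ (X : Type*) : Type _ := X ⊕ Unit

/-- The action space `[0, ∞] × A`. -/
abbrev Action (A : Type*) : Type _ := ℝ≥0∞ × A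

namespace Model

variable {X A : Type*} [TopologicalSpace X] [MeasurableSpace X] [MeasurableSpace A] {J : ℕ}
  (M : Model X A J)

/-- `e^{-αθ}`, with `e^{-α∞} = 0`. -/
def discount (θ : ℝ≥0∞) : ℝ≥0∞ :=
  if θ = ∞ then 0 else ENNReal.ofReal (Real.exp (-M.α * θ.toReal))

lemma measurable_discount : Measurable M.discount := by
  unfold discount
  refine Measurable.ite (measurableSet_singleton _) measurable_const ?_
  fun_prop

lemma discount_le_one (θ : ℝ≥0∞) : M.discount θ ≤ 1 := by
  unfold discount
  split_ifs
  · simp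
  · rw [ENNReal.ofReal_le_one, Real.exp_le_one_iff]
    have := mul_nonneg M.α_pos.le (ENNReal.toReal_nonneg (a := θ))
    linarith

/-- The transition law: from `x ∈ X`, under the action `(θ, a)`, the next state is
`l(φ(x, θ), a)` with probability `e^{-αθ}` and `Δ` otherwise (when `θ = ∞` the first weight is zero);
`Δ` is absorbing. -/
def transitionLaw : StateΔ X × Action A → Measure (StateΔ X)
  | (Sum.inl x, (θ, a)) =>
      M.discount θ • Measure.dirac (Sum.inl (M.jump (M.flow x θ.toNNReal, a))) +
        (1 - M.discount θ) • Measure.dirac (Sum.inr ())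
  | (Sum.inr _, _) => Measure.dirac (Sum.inr ())

lemma measurable_transitionLaw : Measurable M.transitionLaw := by
  have key : Measurable (M.transitionLaw ∘
      (MeasurableEquiv.sumProdDistrib X Unit (Action A)).symm) := by
    refine measurable_fun_sum ?_ ?_
    · change Measurable fun p : X × Action A =>
        M.discount p.2.1 • Measure.dirac
          (Sum.inl (M.jump (M.flow p.1 p.2.1.toNNReal, p.2.2)) : StateΔ X) +
        (1 - M.discount p.2.1) • Measure.dirac (Sum.inr () : StateΔ X)
      have hflow : Measurable fun p : X × Action A => M.flow p.1 p.2.1.toNNReal :=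
        M.measurable_flow.comp
          (measurable_fst.prodMk (measurable_snd.fst.ennreal_toNNReal))
      have hjump : Measurable fun p : X × Action A =>
          (Sum.inl (M.jump (M.flow p.1 p.2.1.toNNReal, p.2.2)) : StateΔ X) :=
        measurable_inl.comp (M.measurable_jump.comp (hflow.prodMk measurable_snd.snd))
      have hdisc : Measurable fun p : X × Action A => M.discount p.2.1 :=
        M.measurable_discount.comp measurable_snd.fst
      refine Measure.measurable_of_measurable_coe _ fun s hs => ?_
      simp only [Measure.add_apply, Measure.smul_apply, smul_eq_mul]
      exact (hdisc.mul ((Measure.measurable_coe hs).comp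
        (Measure.measurable_dirac.comp hjump))).add
          ((measurable_const.sub hdisc).mul measurable_const)
    · exact measurable_const
  have := key.comp (MeasurableEquiv.sumProdDistrib X Unit (Action A)).measurable
  simpa [Function.comp_assoc] using this

/-- The transition law `Q` of the induced MDP, as a kernel. -/
def Q : Kernel (StateΔ X × Action A) (StateΔ X) where
  toFun := M.transitionLaw
  measurable' := M.measurable_transitionLaw

instance : IsMarkovKernel M.Q where
  isProbabilityMeasure := by
    rintro ⟨x | x, θ, a⟩
    · refine ⟨?_⟩
      change (M.discount θ • (Measure.dirac (Sum.inl (M.jump (M.flow x θ.toNNReal, a))) :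
          Measure (StateΔ X)) +
        (1 - M.discount θ) • (Measure.dirac (Sum.inr ()) : Measure (StateΔ X))) Set.univ = 1
      simp [add_tsub_cancel_of_le (M.discount_le_one θ)]
    · change IsProbabilityMeasure (Measure.dirac (Sum.inr () : StateΔ X))
      infer_instance

/-- The one-step costs of the induced MDP,
`∫₀^θ e^{-αt} C^g_j(φ(x, t)) dt + e^{-αθ} C^I_j(φ(x, θ), a)` at `x ∈ X` (the second term vanishes when
`θ = ∞`, since `0 * ∞ = 0`), and `0` at `Δ`. -/
def cost (j : Fin (J + 1)) : StateΔ X × Action A → ℝ≥0∞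
  | (Sum.inl x, (θ, a)) =>
      (∫⁻ t in {t : ℝ | 0 ≤ t ∧ ENNReal.ofReal t ≤ θ},
        ENNReal.ofReal (Real.exp (-M.α * t)) * M.costRate j (M.flow x t.toNNReal)) +
        M.discount θ * M.impulseCost j (M.flow x θ.toNNReal, a)
  | (Sum.inr _, _) => 0

end Model

end ImpulseControl

end

/-!
# Absence of a relaxation gap for semicontinuous Markov decision processes

The argument applies to every semicontinuous Markov decision process with nonnegative costs on a
metrizable standard Borel state space `Y`; the structure of the impulse control model is not needed
beyond the fact that `X ⊕ Unit` is such a space.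

All the costs of a strategy depend only on the laws `pₙ` of the pairs `(xₙ, bₙ₊₁)`. These laws form a
flow (`IsFlow`): `p₀` has first marginal `δ_x`, and `pₙ₊₁` has first marginal `pₙ Q`. Conversely, every
flow comes from a Markov strategy, by disintegration.

*Bellman function.* Value iteration from zero increases to a lower semicontinuous function. As `B` is
compact, this limit solves the Bellman equation (`iSup_valueIter_eq`) and a measurable minimizer `f`
exists (`exists_measurable_argmin`). The limit bounds the value of each strategy from below, and `f`
attains it. Hence selectors exist, outside `V` they incur no cost and never return to `V`, and `V` is
exhausted by the sets where the minimal cost over `n` steps is at least `ε`. Each visit to such a set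
costs at least `ε` within `n` steps, which makes the occupation measure σ-finite on `V` as soon as the
total cost is finite (`sigmaFinite_restrictV_occupation`).

*Existence.* The set of flows is sequentially compact for weak convergence at each time
(`exists_subseq_flow`): `Y` embeds in the Hilbert cube, where limits exist by compactness, and the
limits are carried by `Y` since their state marginals are determined by the previous step. The costs
are lower semicontinuous, so a minimizing sequence has an optimal limit. Replacing its actions by `f`
outside `V` does not increase the costs (`exists_strategy_le_of_isFlow`).

*No gap.* If a strategy applies `f` outside `V`, its occupation measure restricted to `V × B` solves
the characteristic equation and carries all the costs (`InClassPi.relaxedFeasible`). Conversely, let `μ`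
be feasible in the relaxed problem and induce the stationary strategy `s`. By induction on time, the
occupation measure of `s` on `V` is bounded by `μ`, as the minimal solution of the characteristic
equation of `s`, so that `s` does not cost more than `μ` (`value_stationary_le_relaxedCost`).
-/

namespace ImpulseControl

/-! ### The sum of two topological spaces -/

section Sum

lemma borelSpace_sum (X Y : Type*) [TopologicalSpace X] [MeasurableSpace X] [BorelSpace X]
    [TopologicalSpace Y] [MeasurableSpace Y] [BorelSpace Y] : BorelSpace (X ⊕ Y) := by
  refine ⟨le_antisymm ?_ ?_⟩
  · intro s hs
    have hl : MeasurableSet (Sum.inl ⁻¹' s : Set X) := measurable_inl hs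
    have hr : MeasurableSet (Sum.inr ⁻¹' s : Set Y) := measurable_inr hs
    let : MeasurableSpace (X ⊕ Y) := borel _
    have : BorelSpace (X ⊕ Y) := ⟨rfl⟩
    rw [← Set.image_preimage_inl_union_image_preimage_inr s]
    exact (IsOpenEmbedding.inl.measurableEmbedding.measurableSet_image.2 hl).union
      (IsOpenEmbedding.inr.measurableEmbedding.measurableSet_image.2 hr)
  · refine MeasurableSpace.generateFrom_le fun s hs => measurableSet_sum_iff.2 ?_
    exact ⟨(hs.preimage continuous_inl).measurableSet, (hs.preimage continuous_inr).measurableSet⟩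

lemma metrizableSpace_sum (X Y : Type*) [TopologicalSpace X] [TopologicalSpace.MetrizableSpace X]
    [TopologicalSpace Y] [TopologicalSpace.MetrizableSpace Y] :
    TopologicalSpace.MetrizableSpace (X ⊕ Y) := by
  let := TopologicalSpace.metrizableSpaceMetric X
  let := TopologicalSpace.metrizableSpaceMetric Y
  let : MetricSpace (X ⊕ Y) := Metric.metricSpaceSum
  infer_instance

lemma standardBorelSpace_sum (X Y : Type*) [MeasurableSpace X] [StandardBorelSpace X]
    [MeasurableSpace Y] [StandardBorelSpace Y] : StandardBorelSpace (X ⊕ Y) := by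
  let := upgradeStandardBorel X
  let := upgradeStandardBorel Y
  have := borelSpace_sum X Y
  infer_instance

end Sum

/-! ### Lower semicontinuity and measurable selection -/

section Lsc

/-- Weak convergence and lower semicontinuous integrands: for a truncated integrand the layer cake
formula reduces the claim to the open sets `{f > t}`. -/
lemma lintegral_le_liminf_of_tendsto {Ω : Type*} [TopologicalSpace Ω] [MeasurableSpace Ω]
    [OpensMeasurableSpace Ω] [HasOuterApproxClosed Ω] {f : Ω → ℝ≥0∞}
    (hf : LowerSemicontinuous f) {μ : ProbabilityMeasure Ω} {μs : ℕ → ProbabilityMeasure Ω}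
    (h : Tendsto μs atTop (𝓝 μ)) :
    ∫⁻ x, f x ∂(μ : Measure Ω) ≤ atTop.liminf fun k => ∫⁻ x, f x ∂(μs k : Measure Ω) := by
  have hfm : Measurable f := hf.measurable
  have layer (N : ℕ) (ν : Measure Ω) : ∫⁻ x, min (f x) N ∂ν =
      ∫⁻ t in Set.Ioi (0 : ℝ), ν {x | t < (min (f x) N).toReal} := by
    rw [← lintegral_eq_lintegral_meas_lt ν (Eventually.of_forall fun _ => ENNReal.toReal_nonneg)
      (hfm.min measurable_const).ennreal_toReal.aemeasurable]
    refine lintegral_congr fun x => (ENNReal.ofReal_toReal ?_).symm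
    exact ((min_le_right _ _).trans_lt (ENNReal.natCast_lt_top N)).ne
  have hopen (N : ℕ) (t : ℝ) (ht : t ∈ Set.Ioi (0 : ℝ)) :
      IsOpen {x | t < (min (f x) N).toReal} := by
    have : {x | t < (min (f x) N).toReal} =
        if t < N then f ⁻¹' Set.Ioi (ENNReal.ofReal t) else ∅ := by
      have key (x : Ω) : t < (min (f x) N).toReal ↔ ENNReal.ofReal t < f x ∧ t < N := by
        rw [← ENNReal.ofReal_lt_iff_lt_toReal (le_of_lt ht)
          ((min_le_right _ _).trans_lt (ENNReal.natCast_lt_top N)).ne, lt_min_iff]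
        refine and_congr_right fun _ => ?_
        rw [← ENNReal.ofReal_natCast, ENNReal.ofReal_lt_ofReal_iff_of_nonneg (le_of_lt ht)]
      ext x
      split_ifs with hN <;> simp [key, hN]
    rw [this]
    split_ifs
    · exact hf.isOpen_preimage _
    · exact isOpen_empty
  have trunc (N : ℕ) : ∫⁻ x, min (f x) N ∂(μ : Measure Ω) ≤
      atTop.liminf fun k => ∫⁻ x, f x ∂(μs k : Measure Ω) := by
    calc ∫⁻ x, min (f x) N ∂(μ : Measure Ω)
        = ∫⁻ t in Set.Ioi (0 : ℝ), (μ : Measure Ω) {x | t < (min (f x) N).toReal} := layer N _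
      _ ≤ ∫⁻ t in Set.Ioi (0 : ℝ), atTop.liminf
            fun k => (μs k : Measure Ω) {x | t < (min (f x) N).toReal} :=
          setLIntegral_mono' measurableSet_Ioi fun t ht =>
            ProbabilityMeasure.le_liminf_measure_open_of_tendsto h (hopen N t ht)
      _ ≤ atTop.liminf fun k => ∫⁻ t in Set.Ioi (0 : ℝ),
            (μs k : Measure Ω) {x | t < (min (f x) N).toReal} :=
          lintegral_liminf_le fun k => Antitone.measurable fun s t hst =>
            measure_mono fun x hx => lt_of_le_of_lt hst hx
      _ ≤ _ := by
          refine liminf_le_liminf (Eventually.of_forall fun k => ?_)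
          rw [← layer]
          exact lintegral_mono fun x => min_le_left _ _
  have hsup (x : Ω) : f x = ⨆ N : ℕ, min (f x) N := by
    rw [← inf_iSup_eq, ENNReal.iSup_natCast, inf_top_eq]
  calc ∫⁻ x, f x ∂(μ : Measure Ω) = ∫⁻ x, ⨆ N : ℕ, min (f x) N ∂(μ : Measure Ω) :=
        lintegral_congr hsup
    _ = ⨆ N : ℕ, ∫⁻ x, min (f x) N ∂(μ : Measure Ω) :=
        lintegral_iSup (fun N => hfm.min measurable_const) fun a b hab x =>
          min_le_min_left _ (Nat.cast_le.2 hab)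
    _ ≤ _ := iSup_le trunc

lemma lowerSemicontinuous_of_seq {Z : Type*} [TopologicalSpace Z] [SequentialSpace Z]
    {F : Z → ℝ≥0∞} (h : ∀ (z : Z) (u : ℕ → Z), Tendsto u atTop (𝓝 z) →
      F z ≤ atTop.liminf fun k => F (u k)) : LowerSemicontinuous F := by
  rw [lowerSemicontinuous_iff_isClosed_preimage]
  refine fun c => IsSeqClosed.isClosed fun u z hu hz => ?_
  exact (h z u hz).trans (liminf_le_of_le (by isBoundedDefault)
    fun b hb => (hb.and (Eventually.of_forall hu)).exists.elim fun k hk => hk.1.trans hk.2)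

lemma lsc_section {Y B : Type*} [TopologicalSpace Y] [TopologicalSpace B] {g : Y × B → ℝ≥0∞}
    (hg : LowerSemicontinuous g) (x : Y) : LowerSemicontinuous fun b => g (x, b) :=
  LowerSemicontinuous.comp hg (by fun_prop)

variable {Y B : Type*} [TopologicalSpace Y] [TopologicalSpace B] [CompactSpace B] [Nonempty B]

lemma exists_isMin_of_lsc {g : B → ℝ≥0∞} (hg : LowerSemicontinuous g) :
    ∃ b, g b = ⨅ b', g b' := by
  obtain ⟨b, -, hb⟩ := LowerSemicontinuousOn.exists_isMinOn (s := Set.univ) Set.univ_nonempty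
    isCompact_univ (hg.lowerSemicontinuousOn _)
  exact ⟨b, le_antisymm (le_iInf fun b' => hb (Set.mem_univ b')) (iInf_le _ _)⟩

/-- A partial minimum over a compact space is lower semicontinuous: its sublevel sets are
projections of closed sets along a compact factor. -/
lemma lsc_iInf {g : Y × B → ℝ≥0∞} (hg : LowerSemicontinuous g) :
    LowerSemicontinuous fun x => ⨅ b, g (x, b) := by
  rw [lowerSemicontinuous_iff_isClosed_preimage]
  intro c
  have : (fun x => ⨅ b, g (x, b)) ⁻¹' Set.Iic c = Prod.fst '' (g ⁻¹' Set.Iic c) := by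
    ext x
    constructor
    · intro hx
      obtain ⟨b, hb⟩ := exists_isMin_of_lsc (lsc_section hg x)
      exact ⟨(x, b), hb.le.trans hx, rfl⟩
    · rintro ⟨⟨x', b⟩, hz, rfl⟩
      exact (iInf_le (fun b => g (x', b)) b).trans hz
  rw [this]
  exact isClosedMap_fst_of_compactSpace _ (hg.isClosed_preimage c)

/-- Along an increasing sequence of lower semicontinuous functions on a compact space, the limit
and the minimum can be exchanged, by the finite intersection property of the sublevel sets. -/
lemma iInf_iSup_of_lsc {g : ℕ → B → ℝ≥0∞} (hg : ∀ n, LowerSemicontinuous (g n))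
    (hmono : Monotone g) : ⨅ b, ⨆ n, g n b = ⨆ n, ⨅ b, g n b := by
  refine le_antisymm ?_ (iSup_iInf_le_iInf_iSup _)
  set c := ⨆ n, ⨅ b, g n b
  obtain ⟨b, hb⟩ := IsCompact.nonempty_iInter_of_directed_nonempty_isCompact_isClosed
    (fun n => g n ⁻¹' Set.Iic c)
    (directed_of_isDirected_le fun m n hmn b hb => (hmono hmn b).trans hb)
    (fun n => by
      obtain ⟨b, hb⟩ := exists_isMin_of_lsc (hg n)
      exact ⟨b, hb.le.trans (le_iSup (fun n => ⨅ b, g n b) n)⟩)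
    (fun n => ((hg n).isClosed_preimage c).isCompact)
    (fun n => (hg n).isClosed_preimage c)
  exact (iInf_le _ b).trans (iSup_le fun n => Set.mem_iInter.1 hb n)

/-- **Measurable selection of minimizers.** The compact space `B` is a continuous image of the Cantor
set, so that the minimizers at `x` are coded by a compact set of reals, and the selection takes the
least code. -/
theorem exists_measurable_argmin [TopologicalSpace.MetrizableSpace B] [MeasurableSpace B]
    [BorelSpace B] [MeasurableSpace Y] [OpensMeasurableSpace Y]
    {g : Y × B → ℝ≥0∞} (hg : LowerSemicontinuous g) :
    ∃ f : Y → B, Measurable f ∧ ∀ x, g (x, f x) = ⨅ b, g (x, b) := by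
  let := TopologicalSpace.metrizableSpaceMetric B
  obtain ⟨β₀, hβ₀, hβ₀s⟩ := exists_nat_bool_continuous_surjective_of_compact B
  set β : cantorSet → B := β₀ ∘ cantorSetHomeomorphNatToBool with hβdef
  have hβ : Continuous β := hβ₀.comp cantorSetHomeomorphNatToBool.continuous
  have hβs : Function.Surjective β := hβ₀s.comp cantorSetHomeomorphNatToBool.surjective
  have : CompactSpace cantorSet := isCompact_iff_compactSpace.1 isCompact_cantorSet
  have hgβ : LowerSemicontinuous fun z : Y × cantorSet => g (z.1, β z.2) :=
    LowerSemicontinuous.comp hg (by fun_prop)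
  -- `F x` is the set of the codes of the minimizers at `x`
  let F : Y → Set ℝ := fun x => Subtype.val '' {t : cantorSet | g (x, β t) ≤ ⨅ b, g (x, b)}
  have hFc (x : Y) : IsCompact (F x) :=
    (((lsc_section hgβ x).isClosed_preimage _).isCompact).image continuous_subtype_val
  have hFn (x : Y) : (F x).Nonempty := by
    obtain ⟨b, hb⟩ := exists_isMin_of_lsc (lsc_section hg x)
    obtain ⟨t, rfl⟩ := hβs b
    exact ⟨_, t, hb.le, rfl⟩
  have hmem (x : Y) : sInf (F x) ∈ F x := (hFc x).sInf_mem (hFn x)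
  have hsub (x : Y) : sInf (F x) ∈ cantorSet := by
    obtain ⟨t, -, ht⟩ := hmem x
    exact ht ▸ t.2
  have hmeas : Measurable fun x => sInf (F x) := by
    refine measurable_of_Iic fun r => ?_
    -- the least code is at most `r` if and only if the minimum over the codes `t ≤ r` is the minimum
    -- over `B`; the two minima are lower semicontinuous in `x`
    by_cases hr : (Set.Iic r ∩ cantorSet).Nonempty
    · let K : Set cantorSet := {t | (t : ℝ) ≤ r}
      have hK : IsClosed K := isClosed_le continuous_subtype_val continuous_const
      have : CompactSpace K := isCompact_iff_compactSpace.1 hK.isCompact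
      have : Nonempty K := by
        obtain ⟨t, h1, h2⟩ := hr
        exact ⟨⟨⟨t, h2⟩, h1⟩⟩
      have hgK : LowerSemicontinuous fun z : Y × K => g (z.1, β z.2) :=
        LowerSemicontinuous.comp hg (by fun_prop)
      have : (fun x => sInf (F x)) ⁻¹' Set.Iic r =
          {x | ⨅ t : K, g (x, β t) ≤ ⨅ b, g (x, b)} := by
        ext x
        constructor
        · intro hx
          obtain ⟨t, h1, h2⟩ := hmem x
          have h3 : (t : ℝ) ≤ r := h2.le.trans hx
          exact (iInf_le (fun t : K => g (x, β t)) ⟨t, h3⟩).trans h1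
        · intro hx
          obtain ⟨t, ht⟩ := exists_isMin_of_lsc (lsc_section hgK x)
          exact (csInf_le (hFc x).bddBelow ⟨t.1, ht.le.trans hx, rfl⟩).trans t.2
      rw [this]
      exact measurableSet_le (lsc_iInf hgK).measurable (lsc_iInf hg).measurable
    · convert MeasurableSet.empty
      ext x
      simp only [Set.mem_preimage, Set.mem_Iic, Set.mem_empty_iff_false, iff_false]
      exact fun hx => hr ⟨_, hx, hsub x⟩
  refine ⟨fun x => β ⟨sInf (F x), hsub x⟩, hβ.measurable.comp (hmeas.subtype_mk), fun x => ?_⟩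
  obtain ⟨t, h1, h2⟩ := hmem x
  have : (⟨sInf (F x), hsub x⟩ : cantorSet) = t := Subtype.ext h2.symm
  simp only [this]
  exact le_antisymm h1 (iInf_le _ _)

end Lsc

/-! ### Flows of state-action laws -/

section Flow

variable {Y B : Type*} [MeasurableSpace Y] [MeasurableSpace B]

/-- The law of the pair `(xₙ, bₙ₊₁)` under the strategic measure. -/
noncomputable def pairLaw (Q : Kernel (Y × B) Y) [IsMarkovKernel Q] (π : Strategy Y B) (x : Y)
    (n : ℕ) : Measure (Y × B) :=
  (strategicMeasure Q π x).map fun ω => ω n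

/-- A sequence of laws of state-action pairs that is consistent with the initial state `x` and the
transition law `Q`. The strategy does not appear: by disintegration, each such sequence comes from a
Markov strategy. -/
structure IsFlow (Q : Kernel (Y × B) Y) (x : Y) (p : ℕ → Measure (Y × B)) : Prop where
  init : (p 0).fst = Measure.dirac x
  step : ∀ n, (p (n + 1)).fst = (p n).bind Q

section Basic

variable {Q : Kernel (Y × B) Y} {x : Y}

lemma isProbabilityMeasure_of_fst {μ : Measure (Y × B)} [IsProbabilityMeasure μ.fst] :
    IsProbabilityMeasure μ :=
  ⟨by rw [← Measure.fst_univ]; exact measure_univ⟩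

lemma IsFlow.isProbabilityMeasure [IsMarkovKernel Q] {p : ℕ → Measure (Y × B)}
    (hp : IsFlow Q x p) (n : ℕ) : IsProbabilityMeasure (p n) := by
  induction n with
  | zero =>
    have : IsProbabilityMeasure (p 0).fst := by rw [hp.init]; infer_instance
    exact isProbabilityMeasure_of_fst
  | succ n ih =>
    have : IsProbabilityMeasure (p (n + 1)).fst := by rw [hp.step]; infer_instance
    exact isProbabilityMeasure_of_fst

lemma IsFlow.lintegral_zero {p : ℕ → Measure (Y × B)} (hp : IsFlow Q x p) {g : Y → ℝ≥0∞}
    (hg : Measurable g) : ∫⁻ z, g z.1 ∂(p 0) = g x := by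
  rw [← lintegral_map hg measurable_fst, ← Measure.fst, hp.init, lintegral_dirac' _ hg]

lemma IsFlow.lintegral_succ {p : ℕ → Measure (Y × B)} (hp : IsFlow Q x p) (n : ℕ) {g : Y → ℝ≥0∞}
    (hg : Measurable g) : ∫⁻ z, g z.1 ∂(p (n + 1)) = ∫⁻ z, ∫⁻ y, g y ∂(Q z) ∂(p n) := by
  rw [← lintegral_map hg measurable_fst, ← Measure.fst, hp.step,
    Measure.lintegral_bind Q.measurable.aemeasurable hg.aemeasurable]

variable [IsMarkovKernel Q] {π : Strategy Y B}

instance : IsProbabilityMeasure (initialLaw π x) := by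
  unfold initialLaw
  infer_instance

instance : IsProbabilityMeasure (strategicMeasure Q π x) := by
  unfold strategicMeasure
  infer_instance

instance (n : ℕ) : IsProbabilityMeasure (pairLaw Q π x n) :=
  Measure.isProbabilityMeasure_map (measurable_pi_apply n).aemeasurable

lemma pairLaw_zero : pairLaw Q π x 0 = initialLaw π x := by
  have h : (strategicMeasure Q π x).map (Preorder.frestrictLe 0) =
      (initialLaw π x).map
        (MeasurableEquiv.piUnique (fun _ : Finset.Iic 0 => Y × B)).symm := by
    rw [strategicMeasure, Kernel.trajMeasure, Measure.map_comp _ _ (by fun_prop),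
      Kernel.traj_map_frestrictLe, Kernel.partialTraj_self, Measure.id_comp]
  have h2 : pairLaw Q π x 0 =
      ((strategicMeasure Q π x).map (Preorder.frestrictLe 0)).map (lastPair 0) := by
    rw [Measure.map_map (measurable_lastPair 0) (by fun_prop)]
    rfl
  rw [h2, h, Measure.map_map (measurable_lastPair 0) (by fun_prop)]
  exact Measure.map_id

lemma lintegral_pairLaw_zero {g : Y × B → ℝ≥0∞} (hg : Measurable g) :
    ∫⁻ z, g z ∂(pairLaw Q π x 0) = ∫⁻ b, g (x, b) ∂(π.kernel 0 (Fin.elim0, x)) := by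
  rw [pairLaw_zero, initialLaw, Measure.lintegral_compProd hg, lintegral_dirac']
  · rfl
  · exact hg.lintegral_kernel_prod_right'

/-- The law of `(x₀, b₁), …, (xₙ, bₙ₊₁)`. -/
noncomputable def pathLaw (Q : Kernel (Y × B) Y) [IsMarkovKernel Q] (π : Strategy Y B) (x : Y)
    (n : ℕ) : Measure ((_ : Finset.Iic n) → Y × B) :=
  (strategicMeasure Q π x).map (Preorder.frestrictLe n)

instance (n : ℕ) : IsProbabilityMeasure (pathLaw Q π x n) :=
  Measure.isProbabilityMeasure_map (by fun_prop)

lemma map_lastPair_pathLaw (n : ℕ) : (pathLaw Q π x n).map (lastPair n) = pairLaw Q π x n := by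
  rw [pathLaw, Measure.map_map (measurable_lastPair n) (by fun_prop)]
  rfl

lemma lintegral_pairLaw_succ (n : ℕ) {g : Y × B → ℝ≥0∞} (hg : Measurable g) :
    ∫⁻ z, g z ∂(pairLaw Q π x (n + 1)) =
      ∫⁻ h, ∫⁻ y, ∫⁻ b, g (y, b) ∂(π.kernel (n + 1) (extendHistory n (h, y)))
        ∂(Q (lastPair n h)) ∂(pathLaw Q π x n) := by
  have h1 : pathLaw Q π x n ⊗ₘ stepKernel Q π n =
      (strategicMeasure Q π x).map fun ω => (Preorder.frestrictLe n ω, ω (n + 1)) :=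
    Kernel.map_frestrictLe_trajMeasure_compProd_eq_map_trajMeasure
  have h2 : pairLaw Q π x (n + 1) = (pathLaw Q π x n ⊗ₘ stepKernel Q π n).map Prod.snd := by
    rw [h1, Measure.map_map measurable_snd (by fun_prop)]
    rfl
  rw [h2, lintegral_map hg measurable_snd, Measure.lintegral_compProd (by fun_prop)]
  refine lintegral_congr fun h => ?_
  rw [stepKernel, Kernel.lintegral_compProd _ _ _ hg]
  rfl

lemma isFlow_pairLaw : IsFlow Q x (pairLaw Q π x) where
  init := by
    refine Measure.ext_of_lintegral _ fun g hg => ?_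
    rw [Measure.fst, lintegral_map hg measurable_fst,
      lintegral_pairLaw_zero (g := fun z => g z.1) (hg.comp measurable_fst), lintegral_dirac' _ hg]
    simp
  step n := by
    refine Measure.ext_of_lintegral _ fun g hg => ?_
    rw [Measure.fst, lintegral_map hg measurable_fst,
      lintegral_pairLaw_succ n (g := fun z => g z.1) (hg.comp measurable_fst),
      Measure.lintegral_bind Q.measurable.aemeasurable hg.aemeasurable, ← map_lastPair_pathLaw,
      lintegral_map hg.lintegral_kernel (measurable_lastPair n)]
    simp

/-- The pair `(xₙ, bₙ₊₁)` is obtained by drawing a history and then an action from the strategy. -/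
lemma exists_historyLaw (n : ℕ) : ∃ H : Measure (History Y B n),
    ∀ g : Y × B → ℝ≥0∞, Measurable g →
      ∫⁻ z, g z ∂(pairLaw Q π x n) = ∫⁻ h, ∫⁻ b, g (h.2, b) ∂(π.kernel n h) ∂H := by
  have hm (n : ℕ) {g : Y × B → ℝ≥0∞} (hg : Measurable g) :
      Measurable fun h : History Y B n => ∫⁻ b, g (h.2, b) ∂(π.kernel n h) := by
    have : Measurable fun q : History Y B n × B => g (q.1.2, q.2) := by fun_prop
    exact this.lintegral_kernel_prod_right'
  cases n with
  | zero =>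
    refine ⟨Measure.dirac (Fin.elim0, x), fun g hg => ?_⟩
    rw [lintegral_pairLaw_zero hg, lintegral_dirac' _ (hm 0 hg)]
  | succ n =>
    refine ⟨(pathLaw Q π x n ⊗ₘ Q.comap (lastPair n) (measurable_lastPair n)).map
      (extendHistory n), fun g hg => ?_⟩
    rw [lintegral_pairLaw_succ n hg, lintegral_map (hm _ hg) (measurable_extendHistory n),
      Measure.lintegral_compProd
        (show Measurable fun q => ∫⁻ b, g ((extendHistory n q).2, b)
          ∂(π.kernel (n + 1) (extendHistory n q)) from
          (hm _ hg).comp (measurable_extendHistory n))]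
    rfl

/-- If the actions are drawn from `s n` given the current state only, then the pair `(xₙ, bₙ₊₁)`
disintegrates along `s n`. -/
lemma lintegral_pairLaw_of_markov {s : ℕ → Kernel Y B} [∀ n, IsMarkovKernel (s n)]
    (hs : ∀ n (h : History Y B n), π.kernel n h = s n h.2) (n : ℕ) {g : Y × B → ℝ≥0∞}
    (hg : Measurable g) :
    ∫⁻ z, g z ∂(pairLaw Q π x n) =
      ∫⁻ z, ∫⁻ b, g (z.1, b) ∂(s n z.1) ∂(pairLaw Q π x n) := by
  obtain ⟨H, hH⟩ := exists_historyLaw (Q := Q) (π := π) (x := x) n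
  have hm : Measurable fun y : Y => ∫⁻ b, g (y, b) ∂(s n y) := hg.lintegral_kernel_prod_right'
  rw [hH _ hg, hH (fun z => ∫⁻ b, g (z.1, b) ∂(s n z.1)) (hm.comp measurable_fst)]
  simp [hs]

/-- If the strategy applies `f` at the states of `S`, then so does the flow. -/
lemma ae_pairLaw_eq_of_dirac [MeasurableEq B] {S : Set Y}
    (hS : MeasurableSet S) {f : Y → B} (hf : Measurable f)
    (hπ : ∀ n (h : History Y B n), h.2 ∈ S → π.kernel n h = Measure.dirac (f h.2)) (n : ℕ) :
    ∀ᵐ z ∂(pairLaw Q π x n), z.1 ∈ S → z.2 = f z.1 := by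
  obtain ⟨H, hH⟩ := exists_historyLaw (Q := Q) (π := π) (x := x) n
  let N : Set (Y × B) := {z | z.1 ∈ S ∧ z.2 = f z.1}ᶜ ∩ {z | z.1 ∈ S}
  have hE : MeasurableSet {z : Y × B | z.1 ∈ S ∧ z.2 = f z.1} :=
    (measurable_fst hS).inter (measurableSet_eq_fun measurable_snd (hf.comp measurable_fst))
  have hN : MeasurableSet N := hE.compl.inter (measurable_fst hS)
  have h0 : pairLaw Q π x n N = 0 := by
    rw [← lintegral_indicator_one hN, hH _ (measurable_one.indicator hN)]
    refine lintegral_eq_zero_of_ae_eq_zero (Eventually.of_forall fun h => ?_)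
    by_cases hh : h.2 ∈ S
    · have hm : Measurable fun b => N.indicator (1 : Y × B → ℝ≥0∞) (h.2, b) :=
        (measurable_one.indicator hN).comp (by fun_prop)
      simp only [hπ n h hh, Pi.zero_apply]
      rw [lintegral_dirac' _ hm, Set.indicator_of_notMem]
      simp [N, hh]
    · simp only [Pi.zero_apply]
      refine (lintegral_congr fun b => ?_).trans lintegral_zero
      rw [Set.indicator_of_notMem]
      simp [N, hh]
  rw [ae_iff]
  refine measure_mono_null (fun z hz => ?_) h0
  simp only [Set.mem_ofPred_eq, Classical.not_imp] at hz
  exact ⟨fun h => hz.2 h.2, hz.1⟩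

lemma value_eq_tsum {C : Y × B → ℝ≥0∞} (hC : Measurable C) :
    value Q C x π = ∑' n, ∫⁻ z, C z ∂(pairLaw Q π x n) := by
  rw [value, lintegral_tsum fun n =>
    (show Measurable fun ω : ℕ → Y × B => C (ω n) from
      hC.comp (measurable_pi_apply n)).aemeasurable]
  exact tsum_congr fun n => (lintegral_map hC (measurable_pi_apply n)).symm

end Basic

end Flow

/-! ### Value iteration and the Bellman equation -/

section ValueIteration

variable {Y B : Type*} [MeasurableSpace Y] [MeasurableSpace B]

/-- Value iteration started at zero: the minimal expected cost over `n` steps. -/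
noncomputable def valueIter (Q : Kernel (Y × B) Y) (C : Y × B → ℝ≥0∞) : ℕ → Y → ℝ≥0∞
  | 0, _ => 0
  | n + 1, x => ⨅ b, (C (x, b) + ∫⁻ y, valueIter Q C n y ∂(Q (x, b)))

variable {Q : Kernel (Y × B) Y} {C : Y × B → ℝ≥0∞}

lemma monotone_valueIter : Monotone (valueIter Q C) := by
  refine monotone_nat_of_le_succ fun n => ?_
  induction n with
  | zero => exact fun x => zero_le
  | succ n ih =>
    exact fun x => iInf_mono fun b => add_le_add le_rfl (lintegral_mono ih)

/-- From time `i` on, `n` steps cost at least as much as value iteration predicts, whatever the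
strategy. -/
lemma IsFlow.lintegral_valueIter_le {x : Y} {p : ℕ → Measure (Y × B)} (hp : IsFlow Q x p)
    (hC : Measurable C) (hW : ∀ n, Measurable (valueIter Q C n)) (n i : ℕ) :
    ∫⁻ z, valueIter Q C n z.1 ∂(p i) ≤ ∑ k ∈ Finset.range n, ∫⁻ z, C z ∂(p (k + i)) := by
  induction n generalizing i with
  | zero => simp [valueIter]
  | succ n ih =>
    calc ∫⁻ z, valueIter Q C (n + 1) z.1 ∂(p i)
        ≤ ∫⁻ z, (C z + ∫⁻ y, valueIter Q C n y ∂(Q z)) ∂(p i) :=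
          lintegral_mono fun z => iInf_le
            (fun b => C (z.1, b) + ∫⁻ y, valueIter Q C n y ∂(Q (z.1, b))) z.2
      _ = ∫⁻ z, C z ∂(p i) + ∫⁻ z, valueIter Q C n z.1 ∂(p (i + 1)) := by
          rw [lintegral_add_left hC, hp.lintegral_succ i (hW n)]
      _ ≤ _ := by
          rw [Finset.sum_range_succ', add_comm, zero_add]
          refine add_le_add ((ih (i + 1)).trans_eq (Finset.sum_congr rfl fun k _ => ?_)) le_rfl
          rw [add_assoc, add_comm 1 i]

/-- Each visit to a state where the minimal cost over `n` steps is at least `ε` costs at least `ε`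
within `n` steps, so that the expected number of these visits is controlled by the total cost. -/
lemma IsFlow.tsum_lintegral_valueIter_le {x : Y} {p : ℕ → Measure (Y × B)} (hp : IsFlow Q x p)
    (hC : Measurable C) (hW : ∀ n, Measurable (valueIter Q C n)) (n : ℕ) :
    ∑' i, ∫⁻ z, valueIter Q C n z.1 ∂(p i) ≤ n * ∑' i, ∫⁻ z, C z ∂(p i) := by
  calc ∑' i, ∫⁻ z, valueIter Q C n z.1 ∂(p i)
      ≤ ∑' i, ∑ k ∈ Finset.range n, ∫⁻ z, C z ∂(p (k + i)) :=
        ENNReal.tsum_le_tsum fun i => hp.lintegral_valueIter_le hC hW n i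
    _ = ∑ k ∈ Finset.range n, ∑' i, ∫⁻ z, C z ∂(p (k + i)) :=
        Summable.tsum_finsetSum fun k _ => ENNReal.summable
    _ ≤ ∑ _k ∈ Finset.range n, ∑' i, ∫⁻ z, C z ∂(p i) :=
        Finset.sum_le_sum fun k _ => ENNReal.tsum_comp_le_tsum_of_injective
          (add_right_injective k) fun i => ∫⁻ z, C z ∂(p i)
    _ = _ := by simp

/-- A nonnegative solution `W` of the equation of `f` dominates the value of `f`, as iterating the
equation leaves a nonnegative remainder. -/
lemma value_detStationary_le [IsMarkovKernel Q] (hC : Measurable C) {W : Y → ℝ≥0∞}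
    (hW : Measurable W) {f : Y → B} (hf : Measurable f)
    (h : ∀ x, C (x, f x) + ∫⁻ y, W y ∂(Q (x, f x)) = W x) (x : Y) :
    value Q C x (Strategy.detStationary f hf) ≤ W x := by
  set p := pairLaw Q (Strategy.detStationary f hf) x
  have hp : IsFlow Q x p := isFlow_pairLaw
  have hdet (n : ℕ) {g : Y × B → ℝ≥0∞} (hg : Measurable g) :
      ∫⁻ z, g z ∂(p n) = ∫⁻ z, g (z.1, f z.1) ∂(p n) := by
    rw [lintegral_pairLaw_of_markov (s := fun _ => Kernel.deterministic f hf)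
      (fun n h => rfl) n hg]
    refine lintegral_congr fun z => ?_
    rw [Kernel.deterministic_apply,
      lintegral_dirac' (a := f z.1) (f := fun b => g (z.1, b)) (hg.comp (by fun_prop))]
  have hstep (n : ℕ) : ∫⁻ z, W z.1 ∂(p n) = ∫⁻ z, C z ∂(p n) + ∫⁻ z, W z.1 ∂(p (n + 1)) := by
    rw [hp.lintegral_succ n hW, ← lintegral_add_left hC, 
      hdet n (g := fun z => C z + ∫⁻ y, W y ∂(Q z)) (hC.add hW.lintegral_kernel)]
    exact lintegral_congr fun z => (h z.1).symm
  have hsum (n : ℕ) :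
      ∑ k ∈ Finset.range n, ∫⁻ z, C z ∂(p k) + ∫⁻ z, W z.1 ∂(p n) = W x := by
    induction n with
    | zero => simp [hp.lintegral_zero hW]
    | succ n ih => rw [Finset.sum_range_succ, add_assoc, ← hstep, ih]
  rw [value_eq_tsum hC]
  exact ENNReal.tsum_le_of_sum_range_le fun n => le_self_add.trans_eq (hsum n)

/-- Outside `V` a selector incurs no cost. -/
lemma IsSelector.cost_eq_zero {J : ℕ} {C : Fin (J + 1) → Y × B → ℝ≥0∞} [IsMarkovKernel Q]
    {f : Y → B}
    (hf : IsSelector Q C f) {x : Y} (hx : x ∉ posSet Q C) (j : Fin (J + 1)) :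
    C j (x, f x) = 0 := by
  have h0 : bellman Q (totalCost C) x = 0 := by simpa [posSet] using hx
  have h := (hf.attains_bellman x).trans (hf.bellman_eq x).symm
  rw [h0, add_eq_zero] at h
  exact (Finset.sum_eq_zero_iff.1 h.1) j (Finset.mem_univ j)

end ValueIteration

lemma lsc_totalCost {Y B : Type*} [TopologicalSpace Y] [TopologicalSpace B] {J : ℕ}
    {C : Fin (J + 1) → Y × B → ℝ≥0∞}
    (hC : ∀ j, LowerSemicontinuous (C j)) : LowerSemicontinuous (totalCost C) :=
  lowerSemicontinuous_sum fun j _ => hC j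

section WeakContinuity

variable {Y B : Type*} [TopologicalSpace Y] [MeasurableSpace Y] [OpensMeasurableSpace Y]
  [TopologicalSpace B] [MeasurableSpace B]

/-- The transition law is weakly continuous. -/
def WeaklyContinuous (Q : Kernel (Y × B) Y) : Prop :=
  ∀ u : Y →ᵇ ℝ, Continuous fun z : Y × B => ∫ y, u y ∂(Q z)

variable {Q : Kernel (Y × B) Y} [IsMarkovKernel Q]

/-- The transition law as a map into probability measures. -/
def transitionProb (Q : Kernel (Y × B) Y) [IsMarkovKernel Q] (z : Y × B) : ProbabilityMeasure Y :=
  ⟨Q z, inferInstance⟩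

lemma WeaklyContinuous.continuous (hQ : WeaklyContinuous Q) : Continuous (transitionProb Q) := by
  rw [continuous_iff_continuousAt]
  intro z
  exact ProbabilityMeasure.tendsto_iff_forall_integral_tendsto.2 fun u => (hQ u).continuousAt

end WeakContinuity

section DP

variable {Y B : Type*} [TopologicalSpace Y] [TopologicalSpace.MetrizableSpace Y]
  [MeasurableSpace Y] [BorelSpace Y] [TopologicalSpace B] [TopologicalSpace.MetrizableSpace B]
  [MeasurableSpace B]

variable {Q : Kernel (Y × B) Y} [IsMarkovKernel Q]

lemma WeaklyContinuous.lsc_lintegral (hQ : WeaklyContinuous Q) {u : Y → ℝ≥0∞}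
    (hu : LowerSemicontinuous u) : LowerSemicontinuous fun z => ∫⁻ y, u y ∂(Q z) :=
  lowerSemicontinuous_of_seq fun z _ hz =>
    lintegral_le_liminf_of_tendsto hu ((hQ.continuous.tendsto z).comp hz)

variable {C : Y × B → ℝ≥0∞} [CompactSpace B] [Nonempty B]

lemma lsc_valueIter (hQ : WeaklyContinuous Q) (hC : LowerSemicontinuous C) (n : ℕ) :
    LowerSemicontinuous (valueIter Q C n) := by
  induction n with
  | zero => exact lowerSemicontinuous_const
  | succ n ih => exact lsc_iInf (hC.add (hQ.lsc_lintegral ih))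

lemma measurable_valueIter (hQ : WeaklyContinuous Q) (hC : LowerSemicontinuous C) (n : ℕ) :
    Measurable (valueIter Q C n) :=
  (lsc_valueIter hQ hC n).measurable

lemma lsc_iSup_valueIter (hQ : WeaklyContinuous Q) (hC : LowerSemicontinuous C) :
    LowerSemicontinuous fun x => ⨆ n, valueIter Q C n x :=
  lowerSemicontinuous_iSup fun n => lsc_valueIter hQ hC n

/-- The limit of value iteration solves the Bellman equation: compactness of the action space
allows to exchange the limit with the minimum. -/
lemma iSup_valueIter_eq (hQ : WeaklyContinuous Q) (hC : LowerSemicontinuous C) (x : Y) :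
    ⨆ n, valueIter Q C n x =
      ⨅ b, (C (x, b) + ∫⁻ y, ⨆ n, valueIter Q C n y ∂(Q (x, b))) := by
  have hlsc (n : ℕ) :
      LowerSemicontinuous fun b => C (x, b) + ∫⁻ y, valueIter Q C n y ∂(Q (x, b)) :=
    lsc_section (hC.add (hQ.lsc_lintegral (lsc_valueIter hQ hC n))) x
  calc ⨆ n, valueIter Q C n x = ⨆ n, valueIter Q C (n + 1) x :=
        (Monotone.iSup_nat_add (f := fun n => valueIter Q C n x)
          (fun m n h => monotone_valueIter h x) 1).symm
    _ = ⨅ b, ⨆ n, (C (x, b) + ∫⁻ y, valueIter Q C n y ∂(Q (x, b))) :=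
        (iInf_iSup_of_lsc hlsc fun m n h b =>
          add_le_add le_rfl (lintegral_mono (monotone_valueIter h))).symm
    _ = _ := by
        refine iInf_congr fun b => ?_
        rw [← ENNReal.add_iSup, lintegral_iSup (measurable_valueIter hQ hC) monotone_valueIter]

lemma iSup_valueIter_le_value (hQ : WeaklyContinuous Q) (hC : LowerSemicontinuous C)
    [OpensMeasurableSpace (Y × B)] (x : Y) (π : Strategy Y B) :
    ⨆ n, valueIter Q C n x ≤ value Q C x π := by
  refine iSup_le fun n => ?_
  have hp : IsFlow Q x (pairLaw Q π x) := isFlow_pairLaw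
  rw [value_eq_tsum hC.measurable, ← hp.lintegral_zero (measurable_valueIter hQ hC n)]
  exact (hp.lintegral_valueIter_le hC.measurable (measurable_valueIter hQ hC) n 0).trans
    (ENNReal.sum_le_tsum _)

variable [BorelSpace B] [OpensMeasurableSpace (Y × B)]

/-- There is a measurable `f` that minimizes the right-hand side of the optimality equation solved
by the limit of value iteration; this limit is the Bellman function, attained by `f`. -/
lemma exists_minimizer (hQ : WeaklyContinuous Q) (hC : LowerSemicontinuous C) :
    (∀ x, bellman Q C x = ⨆ n, valueIter Q C n x) ∧
    ∃ (f : Y → B) (hf : Measurable f),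
      (∀ x, value Q C x (Strategy.detStationary f hf) = bellman Q C x) ∧
      ∀ x, C (x, f x) + ∫⁻ y, ⨆ n, valueIter Q C n y ∂(Q (x, f x)) =
        ⨅ b, (C (x, b) + ∫⁻ y, ⨆ n, valueIter Q C n y ∂(Q (x, b))) := by
  obtain ⟨f, hf, hmin⟩ := exists_measurable_argmin
    (hC.add (hQ.lsc_lintegral (lsc_iSup_valueIter hQ hC)))
  have hle (x : Y) : value Q C x (Strategy.detStationary f hf) ≤ ⨆ n, valueIter Q C n x :=
    value_detStationary_le hC.measurable (lsc_iSup_valueIter hQ hC).measurable hf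
      (fun x => (hmin x).trans (iSup_valueIter_eq hQ hC x).symm) x
  have hb (x : Y) : bellman Q C x = ⨆ n, valueIter Q C n x :=
    le_antisymm ((iInf_le _ _).trans (hle x))
      (le_iInf fun π => iSup_valueIter_le_value hQ hC x π)
  exact ⟨hb, f, hf, fun x => le_antisymm ((hle x).trans_eq (hb x).symm) (iInf_le _ _), hmin⟩

lemma measurable_bellman (hQ : WeaklyContinuous Q) (hC : LowerSemicontinuous C) :
    Measurable (bellman Q C) := by
  rw [funext (exists_minimizer hQ hC).1]
  exact (lsc_iSup_valueIter hQ hC).measurable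

theorem exists_isSelector {J : ℕ} {C : Fin (J + 1) → Y × B → ℝ≥0∞} (hQ : WeaklyContinuous Q)
    (hC : ∀ j, LowerSemicontinuous (C j)) : ∃ f, IsSelector Q C f := by
  obtain ⟨hb, f, hf, h1, h2⟩ := exists_minimizer hQ (lsc_totalCost hC)
  have hb' : bellman Q (totalCost C) = fun x => ⨆ n, valueIter Q (totalCost C) n x := funext hb
  refine ⟨f, hf, h1, fun x => ?_, fun x => ?_⟩
  · rw [hb']
    exact iSup_valueIter_eq hQ (lsc_totalCost hC) x
  · rw [hb']
    exact h2 x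

lemma measurableSet_posSet {J : ℕ} {C : Fin (J + 1) → Y × B → ℝ≥0∞} (hQ : WeaklyContinuous Q)
    (hC : ∀ j, LowerSemicontinuous (C j)) : MeasurableSet (posSet Q C) :=
  measurableSet_lt measurable_const (measurable_bellman hQ (lsc_totalCost hC))

/-- The complement of `V` is absorbing under a selector. -/
lemma IsSelector.transition_posSet {J : ℕ} {C : Fin (J + 1) → Y × B → ℝ≥0∞} {f : Y → B}
    (hQ : WeaklyContinuous Q) (hC : ∀ j, LowerSemicontinuous (C j))
    (hf : IsSelector Q C f) {x : Y} (hx : x ∉ posSet Q C) :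
    Q (x, f x) (posSet Q C) = 0 := by
  have h0 : bellman Q (totalCost C) x = 0 := by simpa [posSet] using hx
  have h := (hf.attains_bellman x).trans (hf.bellman_eq x).symm
  rw [h0, add_eq_zero] at h
  have h2 := (lintegral_eq_zero_iff (measurable_bellman hQ (lsc_totalCost hC))).1 h.2
  refine measure_mono_null (fun y hy => ?_) (ae_iff.1 h2)
  exact (show 0 < bellman Q (totalCost C) y from hy).ne'

end DP

/-! ### Compactness of the set of flows -/

section Compactness

/-- Let `Y` be embedded in `K`, with measurable image. A sequence of laws on `Y × B` that converges
on `K × B` and whose marginals on `Y` converge on `Y` has a limit on `Y × B`: the marginal on `K` of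
the limit is carried by `Y`. -/
lemma exists_tendsto_of_tendsto_map {Y K B : Type*}
    [TopologicalSpace Y] [TopologicalSpace.MetrizableSpace Y] [SecondCountableTopology Y]
    [MeasurableSpace Y] [BorelSpace Y]
    [TopologicalSpace K] [TopologicalSpace.MetrizableSpace K] [SecondCountableTopology K]
    [MeasurableSpace K] [BorelSpace K]
    [TopologicalSpace B] [TopologicalSpace.MetrizableSpace B] [SecondCountableTopology B]
    [MeasurableSpace B] [BorelSpace B]
    {e : Y → K} (he : IsEmbedding e) (hem : MeasurableEmbedding e)
    {μs : ℕ → ProbabilityMeasure (Y × B)} {P : ProbabilityMeasure (K × B)}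
    (hP : Tendsto (fun k => (μs k).map
      (f := Prod.map e (id : B → B)) (hem.measurable.prodMap measurable_id).aemeasurable)
      atTop (𝓝 P))
    {m : ProbabilityMeasure Y}
    (hm : Tendsto (fun k => (μs k).map (f := Prod.fst) measurable_fst.aemeasurable) atTop (𝓝 m)) :
    ∃ μ : ProbabilityMeasure (Y × B), Tendsto μs atTop (𝓝 μ) := by
  have hE : MeasurableEmbedding (Prod.map e (id : B → B)) := hem.prodMap .id
  -- the marginal of the limit on `K` is the image of `m`
  have h1 := ProbabilityMeasure.tendsto_map_of_tendsto_of_continuous _ _ hP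
    (continuous_fst (X := K) (Y := B))
  have h2 := ProbabilityMeasure.tendsto_map_of_tendsto_of_continuous _ _ hm he.continuous
  have h12 (k : ℕ) : ((μs k).map (f := Prod.map e (id : B → B))
        (hem.measurable.prodMap measurable_id).aemeasurable).map
        (f := Prod.fst) continuous_fst.measurable.aemeasurable =
      ((μs k).map (f := Prod.fst) measurable_fst.aemeasurable).map
        he.continuous.measurable.aemeasurable := by
    refine Subtype.ext ?_
    simp only [ProbabilityMeasure.val_eq_to_measure, ProbabilityMeasure.toMeasure_map]
    rw [Measure.map_map measurable_fst hE.measurable,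
      Measure.map_map hem.measurable measurable_fst]
    rfl
  have h3 : P.map (f := Prod.fst) continuous_fst.measurable.aemeasurable =
      m.map he.continuous.measurable.aemeasurable :=
    tendsto_nhds_unique h1 (by simpa only [h12] using h2)
  have h4 : (P : Measure (K × B)).map Prod.fst = (m : Measure Y).map e := by
    have := congrArg (fun ν : ProbabilityMeasure K => (ν : Measure K)) h3
    simpa only [ProbabilityMeasure.toMeasure_map] using this
  have h5 : (P : Measure (K × B)) (Set.range (Prod.map e (id : B → B)))ᶜ = 0 := by
    have : (Set.range (Prod.map e (id : B → B)))ᶜ = Prod.fst ⁻¹' (Set.range e)ᶜ := by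
      ext z
      simp [Set.range_prodMap]
    rw [this, ← Measure.map_apply measurable_fst hem.measurableSet_range.compl, h4,
      Measure.map_apply hem.measurable hem.measurableSet_range.compl]
    simp
  have h6 : ((P : Measure (K × B)).comap (Prod.map e (id : B → B))).map (Prod.map e id) = P := by
    rw [hE.map_comap]
    exact Measure.restrict_eq_self_of_ae_mem h5
  have hprob : IsProbabilityMeasure ((P : Measure (K × B)).comap (Prod.map e (id : B → B))) := by
    constructor
    have := congrArg (fun ν : Measure (K × B) => ν Set.univ) h6
    simpa [Measure.map_apply hE.measurable MeasurableSet.univ] using this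
  refine ⟨⟨_, hprob⟩, tendsto_of_forall_isOpen_le_liminf' fun G hG => ?_⟩
  obtain ⟨U, hU, rfl⟩ := (he.prodMap .id).isOpen_iff.1 hG
  have h7 := ProbabilityMeasure.le_liminf_measure_open_of_tendsto hP hU
  rw [← h6, Measure.map_apply hE.measurable hU.measurableSet] at h7
  refine h7.trans_eq (congrArg (fun u => liminf u atTop) (funext fun k => ?_))
  rw [ProbabilityMeasure.toMeasure_map, Measure.map_apply hE.measurable hU.measurableSet]

variable {Y B : Type*} [TopologicalSpace Y] [TopologicalSpace.MetrizableSpace Y]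
  [MeasurableSpace Y] [BorelSpace Y]
  [TopologicalSpace B] [TopologicalSpace.MetrizableSpace B] [SecondCountableTopology B]
  [MeasurableSpace B] [BorelSpace B]
  {Q : Kernel (Y × B) Y} [IsMarkovKernel Q]

lemma WeaklyContinuous.tendsto_bind (hQ : WeaklyContinuous Q) {μs : ℕ → ProbabilityMeasure (Y × B)}
    {μ : ProbabilityMeasure (Y × B)} (h : Tendsto μs atTop (𝓝 μ)) {νs : ℕ → ProbabilityMeasure Y}
    {ν : ProbabilityMeasure Y} (hνs : ∀ k, (νs k : Measure Y) = (μs k : Measure (Y × B)).bind Q)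
    (hν : (ν : Measure Y) = (μ : Measure (Y × B)).bind Q) : Tendsto νs atTop (𝓝 ν) := by
  refine tendsto_of_forall_isOpen_le_liminf' fun G hG => ?_
  have hlsc : LowerSemicontinuous fun z => Q z G := by
    refine lowerSemicontinuous_of_seq fun z u hz => ?_
    exact ProbabilityMeasure.le_liminf_measure_open_of_tendsto
      ((hQ.continuous.tendsto z).comp hz) hG
  rw [hν, Measure.bind_apply hG.measurableSet Q.measurable.aemeasurable]
  refine (lintegral_le_liminf_of_tendsto hlsc h).trans_eq
    (congrArg (fun u => liminf u atTop) (funext fun k => ?_))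
  rw [hνs, Measure.bind_apply hG.measurableSet Q.measurable.aemeasurable]

/-- The set of flows is sequentially compact for weak convergence at each time. -/
theorem exists_subseq_flow [SecondCountableTopology Y] [StandardBorelSpace Y] [CompactSpace B]
    (hQ : WeaklyContinuous Q) {x : Y} {p : ℕ → ℕ → Measure (Y × B)} (hp : ∀ k, IsFlow Q x (p k)) :
    ∃ (σ : ℕ → ℕ) (q : ℕ → Measure (Y × B)), StrictMono σ ∧ IsFlow Q x q ∧
      ∀ (n : ℕ) (C : Y × B → ℝ≥0∞), LowerSemicontinuous C →
        ∫⁻ z, C z ∂(q n) ≤ atTop.liminf fun k => ∫⁻ z, C z ∂(p (σ k) n) := by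
  let := TopologicalSpace.metrizableSpaceMetric Y
  obtain ⟨e, he⟩ := Metric.PiNatEmbed.exists_embedding_to_hilbert_cube (X := Y)
  have hem : MeasurableEmbedding e := he.continuous.measurable.measurableEmbedding he.injective
  -- the Hilbert cube times `B` is compact, and so is the space of the sequences of laws on it
  let p' (k n : ℕ) : ProbabilityMeasure (Y × B) := ⟨p k n, (hp k).isProbabilityMeasure n⟩
  obtain ⟨P, σ, hσ, hP⟩ := CompactSpace.tendsto_subseq
    fun k n => (p' k n).map (f := Prod.map e (id : B → B))
      (hem.measurable.prodMap measurable_id).aemeasurable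
  rw [tendsto_pi_nhds] at hP
  have lift (n : ℕ) {m : ProbabilityMeasure Y} (hm : Tendsto (fun k => (p' (σ k) n).map
      (f := Prod.fst) measurable_fst.aemeasurable) atTop (𝓝 m)) :
      ∃ μ, Tendsto (fun k => p' (σ k) n) atTop (𝓝 μ) :=
    exists_tendsto_of_tendsto_map he hem (hP n) hm
  have hfst (n : ℕ) {μ : ProbabilityMeasure (Y × B)}
      (h : Tendsto (fun k => p' (σ k) n) atTop (𝓝 μ)) {m : ProbabilityMeasure Y}
      (hm : Tendsto (fun k => (p' (σ k) n).map
      (f := Prod.fst) measurable_fst.aemeasurable) atTop (𝓝 m)) :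
      (μ : Measure (Y × B)).fst = m := by
    have := tendsto_nhds_unique
      (ProbabilityMeasure.tendsto_map_of_tendsto_of_continuous _ _ h continuous_fst) hm
    have := congrArg (fun ν : ProbabilityMeasure Y => (ν : Measure Y)) this
    simpa only [ProbabilityMeasure.toMeasure_map, Measure.fst] using this
  let m0 : ProbabilityMeasure Y := ⟨Measure.dirac x, inferInstance⟩
  have h0 : Tendsto (fun k => (p' (σ k) 0).map (f := Prod.fst) measurable_fst.aemeasurable)
      atTop (𝓝 m0) := by
    refine tendsto_const_nhds.congr fun k => Subtype.ext ?_
    exact ((hp (σ k)).init).symm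
  let m1 (μ : ProbabilityMeasure (Y × B)) : ProbabilityMeasure Y :=
    ⟨(μ : Measure (Y × B)).bind Q, inferInstance⟩
  have h1 (n : ℕ) {μ : ProbabilityMeasure (Y × B)}
      (h : Tendsto (fun k => p' (σ k) n) atTop (𝓝 μ)) :
      Tendsto (fun k => (p' (σ k) (n + 1)).map (f := Prod.fst) measurable_fst.aemeasurable)
        atTop (𝓝 (m1 μ)) :=
    hQ.tendsto_bind h (fun k => (hp (σ k)).step n) rfl
  -- the state law at time `n + 1` is a continuous function of the pair law at time `n`, so that
  -- convergence on `Y × B` propagates in time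
  have hex (n : ℕ) : ∃ μ, Tendsto (fun k => p' (σ k) n) atTop (𝓝 μ) := by
    induction n with
    | zero => exact lift 0 h0
    | succ n ih =>
      obtain ⟨μ, hμ⟩ := ih
      exact lift (n + 1) (h1 n hμ)
  choose q hq using hex
  refine ⟨σ, fun n => q n, hσ, ⟨hfst 0 (hq 0) h0, fun n => hfst (n + 1) (hq _) (h1 n (hq n))⟩,
    fun n C hC => lintegral_le_liminf_of_tendsto hC (hq n)⟩

/-- Fatou's lemma for series. -/
lemma tsum_liminf_le (a : ℕ → ℕ → ℝ≥0∞) :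
    ∑' n, atTop.liminf (fun k => a k n) ≤ atTop.liminf fun k => ∑' n, a k n := by
  simp only [← lintegral_count]
  exact lintegral_liminf_le fun k => measurable_of_countable _

end Compactness

/-! ### σ-finite measures -/

section SigmaFinite

lemma sigmaFinite_of_lintegral_ne_top {α : Type*} [MeasurableSpace α] {m : Measure α}
    {W : ℕ → α → ℝ≥0∞} (hW : ∀ n, Measurable (W n)) (hfin : ∀ n, ∫⁻ x, W n x ∂m ≠ ∞)
    (hpos : ∀ x, ∃ n, 0 < W n x) : SigmaFinite m := by
  let S : ℕ × ℕ → Set α := fun i => {x | (i.2 + 1 : ℝ≥0∞)⁻¹ ≤ W i.1 x}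
  refine Measure.sigmaFinite_of_countable (S := Set.range S) (Set.countable_range S) ?_ ?_
  · rintro _ ⟨i, rfl⟩
    have h0 : (i.2 + 1 : ℝ≥0∞)⁻¹ ≠ 0 := by simp
    exact (meas_ge_le_lintegral_div (hW i.1).aemeasurable h0 (by simp)).trans_lt
      (ENNReal.div_lt_top (hfin i.1) h0)
  · refine Set.eq_univ_of_forall fun x => ?_
    obtain ⟨n, hn⟩ := hpos x
    obtain ⟨k, hk⟩ := ENNReal.exists_inv_nat_lt hn.ne'
    exact ⟨S (n, k), ⟨(n, k), rfl⟩, (ENNReal.inv_le_inv.2 le_self_add).trans hk.le⟩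

/-- Disintegration of a measure whose first marginal is σ-finite, by passing to an equivalent finite
measure with a density that depends on the first coordinate only. -/
lemma exists_disintegration {α B : Type*} [MeasurableSpace α] [MeasurableSpace B]
    [StandardBorelSpace B] [Nonempty B] (μ : Measure (α × B)) [SigmaFinite μ.fst] :
    ∃ φ : Kernel α B, IsMarkovKernel φ ∧ μ.fst ⊗ₘ φ = μ := by
  obtain ⟨w, hw0, hw, hw1⟩ := exists_pos_lintegral_lt_of_sigmaFinite μ.fst one_ne_zero
  have hwm : Measurable fun z : α × B => (w z.1 : ℝ≥0∞) := by fun_prop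
  have hwi : Measurable fun z : α × B => (w z.1 : ℝ≥0∞)⁻¹ := by fun_prop
  set ρ := μ.withDensity fun z => (w z.1 : ℝ≥0∞) with hρdef
  have hρ : IsFiniteMeasure ρ := by
    constructor
    rw [hρdef, withDensity_apply _ MeasurableSet.univ, setLIntegral_univ,
      ← lintegral_map (f := fun x => (w x : ℝ≥0∞)) (by fun_prop) measurable_fst]
    exact hw1.trans ENNReal.one_lt_top
  have hcancel (x : α) : (w x : ℝ≥0∞) * (w x : ℝ≥0∞)⁻¹ = 1 :=
    ENNReal.mul_inv_cancel (by simpa using (hw0 x).ne') ENNReal.coe_ne_top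
  -- integrals with respect to `μ` in terms of `ρ`
  have hμρ {g : α × B → ℝ≥0∞} (hg : Measurable g) :
      ∫⁻ z, g z ∂μ = ∫⁻ z, (w z.1 : ℝ≥0∞)⁻¹ * g z ∂ρ := by
    rw [lintegral_withDensity_eq_lintegral_mul _ hwm
      (show Measurable fun z : α × B => (w z.1 : ℝ≥0∞)⁻¹ * g z from hwi.mul hg)]
    refine lintegral_congr fun z => ?_
    rw [Pi.mul_apply, ← mul_assoc, hcancel, one_mul]
  refine ⟨ρ.condKernel, inferInstance, Measure.ext_of_lintegral _ fun g hg => ?_⟩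
  have hG : Measurable fun x => ∫⁻ b, g (x, b) ∂(ρ.condKernel x) :=
    hg.lintegral_kernel_prod_right'
  have hwg : Measurable fun z : α × B => (w z.1 : ℝ≥0∞)⁻¹ * g z := hwi.mul hg
  rw [Measure.lintegral_compProd hg, Measure.fst, lintegral_map hG measurable_fst,
    hμρ (g := fun z => ∫⁻ b, g (z.1, b) ∂(ρ.condKernel z.1)) (hG.comp measurable_fst), hμρ hg]
  have h1 : ∫⁻ z, (w z.1 : ℝ≥0∞)⁻¹ * g z ∂ρ =
      ∫⁻ z, (w z.1 : ℝ≥0∞)⁻¹ * g z ∂(ρ.fst ⊗ₘ ρ.condKernel) := by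
    rw [Measure.disintegrate]
  rw [h1, Measure.lintegral_compProd hwg, Measure.fst,
    lintegral_map hwg.lintegral_kernel_prod_right' measurable_fst]
  refine lintegral_congr fun z => ?_
  exact (lintegral_const_mul _ (hg.comp measurable_prodMk_left)).symm

end SigmaFinite

/-! ### Strategies that apply a selector outside `V` -/

section Domination

variable {Y B : Type*} [MeasurableSpace Y] [MeasurableSpace B]

/-- The Markov strategy that applies the stochastic kernel `s n` to the current state at time `n`. -/
noncomputable def Strategy.markov (s : ℕ → Kernel Y B) [∀ n, IsMarkovKernel (s n)] :
    Strategy Y B where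
  kernel n := (s n).comap (fun h : History Y B n => h.2) measurable_snd
  isMarkov _ := inferInstance

variable {Q : Kernel (Y × B) Y} {x : Y} {V : Set Y} {f : Y → B}

/-- If the complement of `V` is absorbing under `f`, and the actions outside `V` are those of `f`,
then only the states of `V` contribute to the flow into `V`. -/
lemma lintegral_transition_eq_indicator {p : Measure (Y × B)}
    (hp : ∀ᵐ z ∂p, z.1 ∉ V → z.2 = f z.1) (hQf : ∀ x ∉ V, Q (x, f x) V = 0)
    {G : Y → ℝ≥0∞} (hG : ∀ y ∉ V, G y = 0) :
    ∫⁻ z, ∫⁻ y, G y ∂(Q z) ∂p =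
      ∫⁻ z, (Prod.fst ⁻¹' V).indicator (fun z => ∫⁻ y, G y ∂(Q z)) z ∂p := by
  refine lintegral_congr_ae (hp.mono fun z hz => ?_)
  by_cases h : z.1 ∈ V
  · simp [h]
  · have hz' : z = (z.1, f z.1) := Prod.ext rfl (hz h)
    have h0 : ∀ᵐ y ∂(Q z), G y = 0 := by
      rw [hz', ae_iff]
      refine measure_mono_null (fun y hy => ?_) (hQf z.1 h)
      exact not_not.1 fun hyV => hy (hG y hyV)
    simp only [Set.mem_preimage, h, not_false_eq_true, Set.indicator_of_notMem]
    exact (lintegral_congr_ae h0).trans lintegral_zero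

/-- If `f` costs nothing outside `V`, then only the states of `V` contribute to the cost. -/
lemma lintegral_cost_eq_indicator {p : Measure (Y × B)}
    (hp : ∀ᵐ z ∂p, z.1 ∉ V → z.2 = f z.1) {C : Y × B → ℝ≥0∞} (hCf : ∀ x ∉ V, C (x, f x) = 0) :
    ∫⁻ z, C z ∂p = ∫⁻ z, (Prod.fst ⁻¹' V).indicator C z ∂p := by
  refine lintegral_congr_ae (hp.mono fun z hz => ?_)
  by_cases h : z.1 ∈ V
  · simp [h]
  · have hz' : z = (z.1, f z.1) := Prod.ext rfl (hz h)
    rw [Set.indicator_of_notMem (by exact h), hz']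
    exact hCf z.1 h

variable [IsMarkovKernel Q]

/-- A Markov strategy that follows the conditional laws of the actions in a flow `p` at the states
of `V`, and `f` elsewhere, visits `V` at most as often as `p`. -/
lemma lintegral_pairLaw_markov_le (hV : MeasurableSet V) (hQf : ∀ x ∉ V, Q (x, f x) V = 0)
    {p : ℕ → Measure (Y × B)} (hp : IsFlow Q x p) {s : ℕ → Kernel Y B}
    [∀ n, IsMarkovKernel (s n)]
    (hs : ∀ n, ∀ᵐ z ∂(pairLaw Q (Strategy.markov s) x n), z.1 ∉ V → z.2 = f z.1)
    (hdis : ∀ n (g : Y × B → ℝ≥0∞), Measurable g → (∀ z, z.1 ∉ V → g z = 0) →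
      ∫⁻ z, g z ∂(p n) = ∫⁻ z, ∫⁻ b, g (z.1, b) ∂(s n z.1) ∂(p n))
    (n : ℕ) {g : Y × B → ℝ≥0∞} (hg : Measurable g) (hgV : ∀ z, z.1 ∉ V → g z = 0) :
    ∫⁻ z, g z ∂(pairLaw Q (Strategy.markov s) x n) ≤ ∫⁻ z, g z ∂(p n) := by
  have hr : IsFlow Q x (pairLaw Q (Strategy.markov s) x) := isFlow_pairLaw
  induction n generalizing g with
  | zero =>
    have hG : Measurable fun y => ∫⁻ b, g (y, b) ∂(s 0 y) := hg.lintegral_kernel_prod_right'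
    rw [lintegral_pairLaw_of_markov (s := s) (fun _ _ => rfl) 0 hg, hdis 0 g hg hgV,
      hr.lintegral_zero hG, hp.lintegral_zero hG]
  | succ n ih =>
    have hG : Measurable fun y => ∫⁻ b, g (y, b) ∂(s (n + 1) y) :=
      hg.lintegral_kernel_prod_right'
    have hGV : ∀ y ∉ V, ∫⁻ b, g (y, b) ∂(s (n + 1) y) = 0 := fun y hy => by
      simp [hgV (y, _) hy]
    rw [lintegral_pairLaw_of_markov (s := s) (fun _ _ => rfl) (n + 1) hg,
      hdis (n + 1) g hg hgV, hr.lintegral_succ n hG, hp.lintegral_succ n hG,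
      lintegral_transition_eq_indicator (hs n) hQf hGV]
    refine (ih (hG.lintegral_kernel.indicator (measurable_fst hV)) fun z hz => ?_).trans
      (lintegral_mono fun z => Set.indicator_le_self _ _ z)
    exact Set.indicator_of_notMem (by exact hz) _

/-- The occupation measure of a stationary strategy that applies `f` outside `V` is, on `V`, the
minimal solution of the characteristic equation. -/
lemma sum_lintegral_pairLaw_stationary_le (hV : MeasurableSet V)
    (hQf : ∀ x ∉ V, Q (x, f x) V = 0) {ν : Measure (Y × B)} {s : Kernel Y B} [IsMarkovKernel s]
    (hs : ∀ n, ∀ᵐ z ∂(pairLaw Q (Strategy.stationary s) x n), z.1 ∉ V → z.2 = f z.1)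
    (hdis : ∀ g : Y × B → ℝ≥0∞, Measurable g →
      ∫⁻ z, g z ∂ν = ∫⁻ z, ∫⁻ b, g (z.1, b) ∂(s z.1) ∂ν)
    (hchar : ∀ G : Y → ℝ≥0∞, Measurable G → (∀ y ∉ V, G y = 0) →
      ∫⁻ z, G z.1 ∂ν = G x + ∫⁻ z, ∫⁻ y, G y ∂(Q z) ∂ν)
    (N : ℕ) {g : Y × B → ℝ≥0∞} (hg : Measurable g) (hgV : ∀ z, z.1 ∉ V → g z = 0) :
    ∑ n ∈ Finset.range N, ∫⁻ z, g z ∂(pairLaw Q (Strategy.stationary s) x n) ≤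
      ∫⁻ z, g z ∂ν := by
  have hr : IsFlow Q x (pairLaw Q (Strategy.stationary s) x) := isFlow_pairLaw
  induction N generalizing g with
  | zero => simp
  | succ N ih =>
    have hG : Measurable fun y => ∫⁻ b, g (y, b) ∂(s y) := hg.lintegral_kernel_prod_right'
    have hGV : ∀ y ∉ V, ∫⁻ b, g (y, b) ∂(s y) = 0 := fun y hy => by simp [hgV (y, _) hy]
    have hmark (n : ℕ) := lintegral_pairLaw_of_markov (Q := Q) (x := x)
      (π := Strategy.stationary s) (s := fun _ => s) (fun _ _ => rfl) n hg
    rw [Finset.sum_range_succ', hmark 0, hr.lintegral_zero hG, hdis g hg, hchar _ hG hGV, add_comm]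
    refine add_le_add le_rfl ?_
    calc ∑ n ∈ Finset.range N, ∫⁻ z, g z ∂(pairLaw Q (Strategy.stationary s) x (n + 1))
        = ∑ n ∈ Finset.range N, ∫⁻ z, (Prod.fst ⁻¹' V).indicator
            (fun z => ∫⁻ y, ∫⁻ b, g (y, b) ∂(s y) ∂(Q z)) z
            ∂(pairLaw Q (Strategy.stationary s) x n) :=
          Finset.sum_congr rfl fun n _ => by
            rw [hmark (n + 1), hr.lintegral_succ n hG,
              lintegral_transition_eq_indicator (hs n) hQf hGV]
      _ ≤ ∫⁻ z, (Prod.fst ⁻¹' V).indicator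
            (fun z => ∫⁻ y, ∫⁻ b, g (y, b) ∂(s y) ∂(Q z)) z ∂ν :=
          ih (hG.lintegral_kernel.indicator (measurable_fst hV))
            fun z hz => Set.indicator_of_notMem (by exact hz) _
      _ ≤ _ := lintegral_mono fun z => Set.indicator_le_self _ _ z

/-- Every flow is improved by a strategy that applies `f` outside `V`. -/
lemma exists_strategy_le_of_isFlow [StandardBorelSpace B] [Nonempty B] (hV : MeasurableSet V)
    (hf : Measurable f) (hQf : ∀ x ∉ V, Q (x, f x) V = 0)
    {p : ℕ → Measure (Y × B)} (hp : IsFlow Q x p) :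
    ∃ π : Strategy Y B,
      (∀ n (h : History Y B n), h.2 ∉ V → π.kernel n h = Measure.dirac (f h.2)) ∧
      ∀ C : Y × B → ℝ≥0∞, Measurable C → (∀ x ∉ V, C (x, f x) = 0) →
        value Q C x π ≤ ∑' n, ∫⁻ z, C z ∂(p n) := by
  classical
  have (n : ℕ) : IsProbabilityMeasure (p n) := hp.isProbabilityMeasure n
  let s (n : ℕ) : Kernel Y B := Kernel.piecewise hV (p n).condKernel (Kernel.deterministic f hf)
  have hsV (n : ℕ) {y : Y} (hy : y ∈ V) : s n y = (p n).condKernel y := by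
    simp [s, Kernel.piecewise_apply, hy]
  have hsV' (n : ℕ) {y : Y} (hy : y ∉ V) : s n y = Measure.dirac (f y) := by
    simp [s, Kernel.piecewise_apply, hy, Kernel.deterministic_apply]
  have hdirac : ∀ n (h : History Y B n), h.2 ∉ V →
      (Strategy.markov s).kernel n h = Measure.dirac (f h.2) := fun n h hh => hsV' n hh
  have hs (n : ℕ) := ae_pairLaw_eq_of_dirac (Q := Q) (x := x) (π := Strategy.markov s) hV.compl hf
    hdirac n
  refine ⟨Strategy.markov s, hdirac, fun C hC hCf => ?_⟩
  rw [value_eq_tsum hC]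
  refine ENNReal.tsum_le_tsum fun n => ?_
  rw [lintegral_cost_eq_indicator (hs n) hCf]
  refine (lintegral_pairLaw_markov_le hV hQf hp hs (fun n g hg hgV => ?_) n
    (hC.indicator (measurable_fst hV))
    (fun z hz => Set.indicator_of_notMem (by exact hz) _)).trans
    (lintegral_mono fun z => Set.indicator_le_self _ _ z)
  have h1 : ∫⁻ z, g z ∂(p n) = ∫⁻ z, g z ∂((p n).fst ⊗ₘ (p n).condKernel) := by
    rw [Measure.disintegrate]
  rw [h1, Measure.lintegral_compProd hg, Measure.fst,
    lintegral_map hg.lintegral_kernel_prod_right' measurable_fst]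
  refine lintegral_congr fun z => ?_
  by_cases hz : z.1 ∈ V
  · rw [hsV n hz]
  · have h0 (b : B) : g (z.1, b) = 0 := hgV _ hz
    simp only [h0, lintegral_zero]

end Domination

/-! ### The relaxed problem -/

section Relaxed

variable {Y B : Type*} [MeasurableSpace Y] [MeasurableSpace B]
  {J : ℕ} {Q : Kernel (Y × B) Y} [IsMarkovKernel Q] {C : Fin (J + 1) → Y × B → ℝ≥0∞}
  {d : Fin J → ℝ≥0} {x : Y} {f : Y → B}

lemma measurableEmbedding_posSet (hV : MeasurableSet (posSet Q C)) :
    MeasurableEmbedding (Prod.map Subtype.val id : posSet Q C × B → Y × B) :=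
  (MeasurableEmbedding.subtype_coe hV).prodMap .id

lemma lintegral_restrictV (hV : MeasurableSet (posSet Q C)) (ν : Measure (Y × B))
    (g : Y × B → ℝ≥0∞) :
    ∫⁻ z, g (z.1.1, z.2) ∂(restrictV Q C ν) =
      ∫⁻ z, (Prod.fst ⁻¹' posSet Q C).indicator g z ∂ν := by
  have hE := measurableEmbedding_posSet (B := B) hV
  have hrange : Set.range (Prod.map Subtype.val id : posSet Q C × B → Y × B) =
      Prod.fst ⁻¹' posSet Q C := by
    ext z
    simp [Set.range_prodMap]
  rw [lintegral_indicator (measurable_fst hV), ← hrange, ← hE.map_comap, hE.lintegral_map]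
  rfl

lemma lintegral_occupation (π : Strategy Y B) (g : Y × B → ℝ≥0∞) :
    ∫⁻ z, g z ∂(occupation Q x π) = ∑' n, ∫⁻ z, g z ∂(pairLaw Q π x n) :=
  lintegral_sum_measure _ _

lemma relaxedCost_restrictV (hV : MeasurableSet (posSet Q C)) {π : Strategy Y B}
    (hπ : ∀ n, ∀ᵐ z ∂(pairLaw Q π x n), z.1 ∉ posSet Q C → z.2 = f z.1) {j : Fin (J + 1)}
    (hC : Measurable (C j)) (hCf : ∀ x ∉ posSet Q C, C j (x, f x) = 0) :
    relaxedCost Q C j (restrictV Q C (occupation Q x π)) = value Q (C j) x π := by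
  rw [relaxedCost, lintegral_restrictV hV, lintegral_occupation, value_eq_tsum hC]
  exact tsum_congr fun n => (lintegral_cost_eq_indicator (hπ n) hCf).symm

lemma value_totalCost (hC : ∀ j, Measurable (C j)) (π : Strategy Y B) :
    value Q (totalCost C) x π = ∑ j, value Q (C j) x π := by
  have hm : Measurable (totalCost C) := Finset.measurable_sum _ fun j _ => hC j
  simp only [value_eq_tsum (hC _), value_eq_tsum hm, totalCost]
  rw [← Summable.tsum_finsetSum fun j _ => ENNReal.summable]
  exact tsum_congr fun n => lintegral_finsetSum _ fun j _ => hC j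

lemma FeasibleFinite.value_totalCost_ne_top (hC : ∀ j, Measurable (C j)) {π : Strategy Y B}
    (hπ : FeasibleFinite Q C d x π) : value Q (totalCost C) x π ≠ ∞ := by
  rw [value_totalCost hC, ENNReal.sum_ne_top]
  intro j _
  refine Fin.cases hπ.2.ne (fun j => ?_) j
  exact ((hπ.1 j).trans_lt ENNReal.coe_lt_top).ne

/-- On `V` the occupation measure of a strategy with a finite total cost is σ-finite, since the sets
where the minimal cost over `n` steps is bounded below exhaust `V`. -/
lemma sigmaFinite_restrictV_occupation (hV : MeasurableSet (posSet Q C)) {π : Strategy Y B}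
    (hC : Measurable (totalCost C)) (hW : ∀ n, Measurable (valueIter Q (totalCost C) n))
    (hb : ∀ x, bellman Q (totalCost C) x = ⨆ n, valueIter Q (totalCost C) n x)
    (hfin : value Q (totalCost C) x π ≠ ∞) :
    SigmaFinite (restrictV Q C (occupation Q x π)).fst := by
  refine sigmaFinite_of_lintegral_ne_top
    (W := fun n (y : posSet Q C) => valueIter Q (totalCost C) n y)
    (fun n => (hW n).comp measurable_subtype_coe) (fun n => ?_) (fun y => ?_)
  · rw [Measure.fst, lintegral_map (by exact (hW n).comp measurable_subtype_coe) measurable_fst,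
      lintegral_restrictV hV _ fun z => valueIter Q (totalCost C) n z.1]
    refine ne_top_of_le_ne_top (ENNReal.mul_ne_top (ENNReal.natCast_ne_top n) hfin)
      ((lintegral_mono fun z => Set.indicator_le_self _ _ z).trans ?_)
    rw [lintegral_occupation, value_eq_tsum hC]
    exact isFlow_pairLaw.tsum_lintegral_valueIter_le hC hW n
  · have h : 0 < bellman Q (totalCost C) y := y.2
    rw [hb] at h
    exact lt_iSup_iff.1 h

/-- Outside `V` the strategy applies `f`, which never leads back to `V`; hence the occupation measure
on `V` solves the characteristic equation, without a contribution of the states outside `V`. -/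
lemma restrictV_occupation_characteristic (hV : MeasurableSet (posSet Q C)) {π : Strategy Y B}
    (hπ : ∀ n, ∀ᵐ z ∂(pairLaw Q π x n), z.1 ∉ posSet Q C → z.2 = f z.1)
    (hQf : ∀ x ∉ posSet Q C, Q (x, f x) (posSet Q C) = 0) {Γ : Set (posSet Q C)}
    (hΓ : MeasurableSet Γ) :
    restrictV Q C (occupation Q x π) (Γ ×ˢ Set.univ) =
      Measure.dirac x (Subtype.val '' Γ) +
        ∫⁻ z, Q (z.1.1, z.2) (Subtype.val '' Γ) ∂(restrictV Q C (occupation Q x π)) := by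
  have hp : IsFlow Q x (pairLaw Q π x) := isFlow_pairLaw
  have hS : MeasurableSet (Subtype.val '' Γ) := hV.subtype_image hΓ
  have hSV : Subtype.val '' Γ ⊆ posSet Q C := Subtype.coe_image_subset _ _
  set S : Set Y := Subtype.val '' Γ with hSdef
  let G : Y → ℝ≥0∞ := S.indicator 1
  have hG : Measurable G := measurable_one.indicator hS
  have hGV : ∀ y ∉ posSet Q C, G y = 0 := fun y hy => Set.indicator_of_notMem (fun h => hy (hSV h)) _
  have hGQ (z : Y × B) : ∫⁻ y, G y ∂(Q z) = Q z S := lintegral_indicator_one hS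
  have h1 : restrictV Q C (occupation Q x π) (Γ ×ˢ Set.univ) =
      ∫⁻ z, G z.1 ∂(occupation Q x π) := by
    rw [restrictV, (measurableEmbedding_posSet hV).comap_apply,
      ← lintegral_indicator_one
        ((measurableEmbedding_posSet hV).measurableSet_image.2 (hΓ.prod MeasurableSet.univ))]
    refine lintegral_congr fun z => ?_
    have : z ∈ Prod.map Subtype.val id '' (Γ ×ˢ (Set.univ : Set B)) ↔ z.1 ∈ S := by
      rw [Set.prodMap_image_prod]
      simp [hSdef]
    by_cases hz : z.1 ∈ S
    · rw [Set.indicator_of_mem (this.2 hz)]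
      simp [G, hz]
    · rw [Set.indicator_of_notMem fun h => hz (this.1 h)]
      simp [G, hz]
  rw [h1, lintegral_restrictV hV _ fun z => Q z S, lintegral_occupation, lintegral_occupation,
    tsum_eq_zero_add' ENNReal.summable, hp.lintegral_zero hG, Measure.dirac_apply' _ hS]
  refine congrArg _ (tsum_congr fun n => ?_)
  rw [hp.lintegral_succ n hG, lintegral_transition_eq_indicator (hπ n) hQf hGV]
  simp only [hGQ]

/-- The characteristic equation, in terms of integrals. -/
lemma RelaxedFeasible.lintegral_fst (hV : MeasurableSet (posSet Q C))
    {μ : Measure (posSet Q C × B)} (hμ : RelaxedFeasible Q C d x μ) {G : Y → ℝ≥0∞}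
    (hG : Measurable G) (hGV : ∀ y ∉ posSet Q C, G y = 0) :
    ∫⁻ z, G z.1.1 ∂μ = G x + ∫⁻ z, ∫⁻ y, G y ∂(Q (z.1.1, z.2)) ∂μ := by
  have he := MeasurableEmbedding.subtype_coe hV
  let Q' : Kernel (posSet Q C × B) Y := Q.comap (Prod.map Subtype.val id)
    (measurableEmbedding_posSet hV).measurable
  have hfst : μ.fst = (Measure.dirac x + μ.bind Q').comap Subtype.val := by
    ext Γ hΓ
    have hS : MeasurableSet (Subtype.val '' Γ) := hV.subtype_image hΓ
    rw [he.comap_apply, Measure.add_apply, Measure.bind_apply hS Q'.measurable.aemeasurable,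
      Measure.fst_apply hΓ, ← Set.prod_univ, hμ.characteristic Γ hΓ]
    rfl
  have hind : (posSet Q C).indicator G = G := by
    ext y
    by_cases hy : y ∈ posSet Q C <;> simp [hy, hGV]
  calc ∫⁻ z, G z.1.1 ∂μ = ∫⁻ y, G y.1 ∂μ.fst :=
        (lintegral_map (hG.comp measurable_subtype_coe) measurable_fst).symm
    _ = ∫⁻ y, G y ∂(Measure.dirac x + μ.bind Q') := by
        rw [hfst, ← he.lintegral_map, he.map_comap, Subtype.range_coe, ← lintegral_indicator hV,
          hind]
    _ = _ := by
        rw [lintegral_add_measure, lintegral_dirac' _ hG,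
          Measure.lintegral_bind Q'.measurable.aemeasurable hG.aemeasurable]
        rfl

/-- A strategy induced by a feasible measure of the relaxed problem does not cost more than this
measure. -/
lemma value_stationary_le_relaxedCost [MeasurableEq B] (hV : MeasurableSet (posSet Q C))
    (hf : Measurable f) (hQf : ∀ x ∉ posSet Q C, Q (x, f x) (posSet Q C) = 0)
    {μ : Measure (posSet Q C × B)} (hμ : RelaxedFeasible Q C d x μ) {s : Kernel Y B}
    [IsMarkovKernel s] (hs : IsInduced Q C f μ s) {j : Fin (J + 1)} (hC : Measurable (C j))
    (hCf : ∀ x ∉ posSet Q C, C j (x, f x) = 0) :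
    value Q (C j) x (Strategy.stationary s) ≤ relaxedCost Q C j μ := by
  obtain ⟨φ, hφ, hdis, hsV, hsf⟩ := hs
  have := hμ.sigmaFinite
  have hE := measurableEmbedding_posSet (B := B) hV
  have hae (n : ℕ) := ae_pairLaw_eq_of_dirac (Q := Q) (x := x) (π := Strategy.stationary s)
    hV.compl hf (fun n h hh => hsf h.2 hh) n
  have hν (g : Y × B → ℝ≥0∞) :
      ∫⁻ z, g z ∂(μ.map (Prod.map Subtype.val id)) = ∫⁻ z, g (z.1.1, z.2) ∂μ := hE.lintegral_map g
  rw [value_eq_tsum hC]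
  refine ENNReal.tsum_le_of_sum_range_le fun N => ?_
  rw [Finset.sum_congr rfl fun n _ => lintegral_cost_eq_indicator (hae n) hCf]
  refine (sum_lintegral_pairLaw_stationary_le (ν := μ.map (Prod.map Subtype.val id)) hV hQf hae
    (fun g hg => ?_) (fun G hG hGV => ?_) N (hC.indicator (measurable_fst hV))
    (fun z hz => Set.indicator_of_notMem (by exact hz) _)).trans
    ((lintegral_mono fun z => Set.indicator_le_self _ _ z).trans_eq (hν _))
  · have hg' : Measurable fun z : posSet Q C × B => g (z.1.1, z.2) := hg.comp hE.measurable
    rw [hν, hν fun z => ∫⁻ b, g (z.1, b) ∂(s z.1)]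
    conv_lhs => rw [← hdis]
    rw [Measure.lintegral_compProd hg', Measure.fst,
      lintegral_map hg'.lintegral_kernel_prod_right' measurable_fst]
    simp only [hsV]
  · rw [hν fun z => G z.1, hν, hμ.lintegral_fst hV hG hGV]

/-- Every measure with a σ-finite marginal induces a stationary strategy. -/
lemma exists_isInduced [StandardBorelSpace B] [Nonempty B] (hV : MeasurableSet (posSet Q C))
    (hf : Measurable f) (μ : Measure (posSet Q C × B)) [SigmaFinite μ.fst] :
    ∃ s : Kernel Y B, IsMarkovKernel s ∧ IsInduced Q C f μ s := by
  obtain ⟨φ, hφ, hdis⟩ := exists_disintegration μ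
  let s : Kernel Y B :=
    { toFun := Function.extend Subtype.val φ fun y => Measure.dirac (f y)
      measurable' := (MeasurableEmbedding.subtype_coe hV).measurable_extend φ.measurable
        (Measure.measurable_dirac.comp hf) }
  have hsV (y : posSet Q C) : s y = φ y :=
    Subtype.val_injective.extend_apply φ (fun y => Measure.dirac (f y)) y
  have hsf (y : Y) (hy : y ∉ posSet Q C) : s y = Measure.dirac (f y) :=
    Function.extend_apply' φ (fun y => Measure.dirac (f y)) y (by rintro ⟨a, rfl⟩; exact hy a.2)
  refine ⟨s, ⟨fun y => ?_⟩, φ, hφ, hdis, hsV, hsf⟩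
  by_cases hy : y ∈ posSet Q C
  · rw [hsV ⟨y, hy⟩]
    infer_instance
  · rw [hsf y hy]
    infer_instance

lemma Optimal.value_eq {π : Strategy Y B} (hπ : Optimal Q C d x π) :
    value Q (C 0) x π = optimalValue Q C d x :=
  le_antisymm (le_iInf₂ hπ.2) (iInf₂_le π hπ.1)

end Relaxed

/-! ### Existence of optimal strategies and the relaxation -/

section Main

variable {Y B : Type*} [TopologicalSpace Y] [TopologicalSpace.MetrizableSpace Y]
  [MeasurableSpace Y] [BorelSpace Y]
  [TopologicalSpace B] [TopologicalSpace.MetrizableSpace B] [SecondCountableTopology B]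
  [MeasurableSpace B] [BorelSpace B] [StandardBorelSpace B] [Nonempty B]
  {J : ℕ} {Q : Kernel (Y × B) Y} [IsMarkovKernel Q] {C : Fin (J + 1) → Y × B → ℝ≥0∞}
  {d : Fin J → ℝ≥0} {x : Y} {f : Y → B}

/-- The restricted occupation measure of a strategy of the class `Π` is feasible in the relaxed
problem, with the same costs. -/
lemma InClassPi.relaxedFeasible [CompactSpace B] (hQ : WeaklyContinuous Q)
    (hC : ∀ j, LowerSemicontinuous (C j)) (hf : IsSelector Q C f) {π : Strategy Y B}
    (hπ : InClassPi Q C d x f π) :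
    RelaxedFeasible Q C d x (restrictV Q C (occupation Q x π)) ∧
      ∀ j, relaxedCost Q C j (restrictV Q C (occupation Q x π)) = value Q (C j) x π := by
  have hCm (j : Fin (J + 1)) : Measurable (C j) := (hC j).measurable
  have hV : MeasurableSet (posSet Q C) := measurableSet_posSet hQ hC
  have hae (n : ℕ) := ae_pairLaw_eq_of_dirac (Q := Q) (x := x) hV.compl hf.measurable hπ.2 n
  have hcost (j : Fin (J + 1)) := relaxedCost_restrictV hV hae (hCm j)
    fun y hy => hf.cost_eq_zero hy j
  refine ⟨⟨?_, fun Γ hΓ => ?_, fun j => (hcost j.succ).trans_le (hπ.1.1 j)⟩, hcost⟩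
  · exact sigmaFinite_restrictV_occupation hV (lsc_totalCost hC).measurable
      (measurable_valueIter hQ (lsc_totalCost hC)) (exists_minimizer hQ (lsc_totalCost hC)).1
      (hπ.1.value_totalCost_ne_top hCm)
  · exact restrictV_occupation_characteristic hV hae (fun y hy => hf.transition_posSet hQ hC hy) hΓ

variable [SecondCountableTopology Y] [StandardBorelSpace Y]

/-- The constrained problem has an optimal strategy that applies the selector `f` outside `V`: a
limit of a minimizing sequence of flows, improved by `f`. -/
theorem exists_optimal [CompactSpace B] (hQ : WeaklyContinuous Q)
    (hC : ∀ j, LowerSemicontinuous (C j)) (hfeas : ∃ π, FeasibleFinite Q C d x π)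
    (hf : IsSelector Q C f) :
    ∃ π, InClassPi Q C d x f π ∧ Optimal Q C d x π := by
  have hCm (j : Fin (J + 1)) : Measurable (C j) := (hC j).measurable
  obtain ⟨π₀, hπ₀, hπ₀fin⟩ := hfeas
  let F : Set ℝ≥0∞ := (fun π => value Q (C 0) x π) '' {π | Feasible Q C d x π}
  obtain ⟨u, -, hu, huF⟩ := exists_seq_tendsto_sInf (S := F) ⟨_, π₀, hπ₀, rfl⟩ (OrderBot.bddBelow _)
  choose π hπ hπu using huF
  obtain ⟨σ, q, hσ, hq, hlim⟩ := exists_subseq_flow hQ (p := fun k => pairLaw Q (π k) x)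
    fun k => isFlow_pairLaw
  have hqval (j : Fin (J + 1)) : ∑' n, ∫⁻ z, C j z ∂(q n) ≤
      atTop.liminf fun k => value Q (C j) x (π (σ k)) := by
    simp only [value_eq_tsum (hCm j)]
    exact (ENNReal.tsum_le_tsum fun n => hlim n (C j) (hC j)).trans (tsum_liminf_le _)
  obtain ⟨π', hπ'f, hπ'⟩ := exists_strategy_le_of_isFlow (measurableSet_posSet hQ hC)
    hf.measurable (fun y hy => hf.transition_posSet hQ hC hy) hq
  have hval (j : Fin (J + 1)) : value Q (C j) x π' ≤
      atTop.liminf fun k => value Q (C j) x (π (σ k)) :=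
    (hπ' (C j) (hCm j) fun y hy => hf.cost_eq_zero hy j).trans (hqval j)
  have hfe : Feasible Q C d x π' := fun j =>
    (hval j.succ).trans (liminf_le_of_le (by isBoundedDefault) fun b hb =>
      hb.exists.elim fun k hk => hk.trans (hπ (σ k) j))
  have h0 : value Q (C 0) x π' ≤ sInf F := by
    refine (hval 0).trans_eq ?_
    simp only [hπu]
    exact (hu.comp hσ.tendsto_atTop).liminf_eq
  have hopt (π'' : Strategy Y B) (h : Feasible Q C d x π'') :
      value Q (C 0) x π' ≤ value Q (C 0) x π'' := h0.trans (sInf_le ⟨π'', h, rfl⟩)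
  exact ⟨π', ⟨⟨hfe, (hopt π₀ hπ₀).trans_lt hπ₀fin⟩, hπ'f⟩, hfe, hopt⟩

/-- The absence of a relaxation gap, for semicontinuous Markov decision processes. -/
theorem relaxation_of_semicontinuous (hsemi : Semicontinuous Q C)
    (hfeas : ∃ π, FeasibleFinite Q C d x π) :
    (∃ f, IsSelector Q C f) ∧
    (optimalValue Q C d x = relaxedValue Q C d x ∧ relaxedValue Q C d x < ∞) ∧
    ∀ f, IsSelector Q C f →
      ((∃ π, InClassPi Q C d x f π ∧ Optimal Q C d x π) ∧
        ∀ π, InClassPi Q C d x f π → Optimal Q C d x π →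
          RelaxedOptimal Q C d x (restrictV Q C (occupation Q x π))) ∧
      ∀ μ, RelaxedOptimal Q C d x μ →
        (∃ s : Kernel Y B, IsMarkovKernel s ∧ IsInduced Q C f μ s) ∧
        ∀ (s : Kernel Y B) [IsMarkovKernel s], IsInduced Q C f μ s →
          InClassPi Q C d x f (Strategy.stationary s) ∧
          Optimal Q C d x (Strategy.stationary s) := by
  have : CompactSpace B := hsemi.compact
  have hQ : WeaklyContinuous Q := hsemi.continuous_transition
  have hC := hsemi.lsc_cost
  have hCm (j : Fin (J + 1)) : Measurable (C j) := (hC j).measurable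
  have hV : MeasurableSet (posSet Q C) := measurableSet_posSet hQ hC
  have hinduced {f : Y → B} (hf : IsSelector Q C f) {μ : Measure (posSet Q C × B)}
      (hμ : RelaxedFeasible Q C d x μ) {s : Kernel Y B} [IsMarkovKernel s]
      (hs : IsInduced Q C f μ s) (j : Fin (J + 1)) :
      value Q (C j) x (Strategy.stationary s) ≤ relaxedCost Q C j μ :=
    value_stationary_le_relaxedCost hV hf.measurable
      (fun y hy => hf.transition_posSet hQ hC hy) hμ hs (hCm j) fun y hy => hf.cost_eq_zero hy j
  obtain ⟨f₀, hf₀⟩ := exists_isSelector hQ hC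
  have hgap : optimalValue Q C d x = relaxedValue Q C d x := by
    refine le_antisymm (le_iInf₂ fun μ hμ => ?_) ?_
    · have := hμ.sigmaFinite
      obtain ⟨s, hs, hind⟩ := exists_isInduced hV hf₀.measurable μ
      exact (iInf₂_le (Strategy.stationary s) fun j =>
        (hinduced hf₀ hμ hind j.succ).trans (hμ.constraint j)).trans (hinduced hf₀ hμ hind 0)
    · obtain ⟨π, hπ, hopt⟩ := exists_optimal hQ hC hfeas hf₀
      obtain ⟨h1, h2⟩ := hπ.relaxedFeasible hQ hC hf₀
      exact (iInf₂_le _ h1).trans_eq ((h2 0).trans hopt.value_eq)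
  have hfin : relaxedValue Q C d x < ∞ := by
    obtain ⟨π, hπ, hπfin⟩ := hfeas
    exact hgap ▸ (iInf₂_le π hπ).trans_lt hπfin
  refine ⟨⟨f₀, hf₀⟩, ⟨hgap, hfin⟩, fun f hf => ⟨⟨exists_optimal hQ hC hfeas hf,
    fun π hπ hopt => ?_⟩, fun μ hμ => ⟨?_, fun s _ hs => ?_⟩⟩⟩
  · obtain ⟨h1, h2⟩ := hπ.relaxedFeasible hQ hC hf
    refine ⟨h1, fun μ' hμ' => ?_⟩
    rw [h2 0, hopt.value_eq, hgap]
    exact iInf₂_le μ' hμ'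
  · have := hμ.1.sigmaFinite
    exact exists_isInduced hV hf.measurable μ
  · have hval : relaxedCost Q C 0 μ = relaxedValue Q C d x :=
      le_antisymm (le_iInf₂ hμ.2) (iInf₂_le μ hμ.1)
    have hfe : Feasible Q C d x (Strategy.stationary s) := fun j =>
      (hinduced hf hμ.1 hs j.succ).trans (hμ.1.constraint j)
    have h0 : value Q (C 0) x (Strategy.stationary s) ≤ relaxedValue Q C d x :=
      (hinduced hf hμ.1 hs 0).trans_eq hval
    refine ⟨⟨⟨hfe, h0.trans_lt hfin⟩, fun n h hh => ?_⟩, hfe, fun π' hπ' => ?_⟩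
    · obtain ⟨φ, -, -, -, hsf⟩ := hs
      exact hsf h.2 hh
    · exact h0.trans (hgap ▸ iInf₂_le π' hπ')

end Main

end ImpulseControl

/-- `X` and `A` range over nonempty Borel subsets of Polish spaces: these are, up to homeomorphism,
the second countable metrizable spaces whose Borel σ-algebra is standard. -/
theorem theorem4p1
    {X A : Type*}
    [TopologicalSpace X] [TopologicalSpace.MetrizableSpace X] [SecondCountableTopology X]
    [MeasurableSpace X] [BorelSpace X] [StandardBorelSpace X]
    [TopologicalSpace A] [TopologicalSpace.MetrizableSpace A] [SecondCountableTopology A]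
    [MeasurableSpace A] [BorelSpace A] [StandardBorelSpace A] [Nonempty A]
    {J : ℕ} (M : ImpulseControl.Model X A J) (x₀ : X)
    (hsemi : ImpulseControl.Semicontinuous M.Q M.cost)
    (hfeas : ∃ π, ImpulseControl.FeasibleFinite M.Q M.cost M.d (Sum.inl x₀) π) :
    -- the strategy `f*` used outside `V` exists
    (∃ f, ImpulseControl.IsSelector M.Q M.cost f) ∧
    -- (a) absence of a relaxation gap, and finiteness
    (ImpulseControl.optimalValue M.Q M.cost M.d (Sum.inl x₀) =
        ImpulseControl.relaxedValue M.Q M.cost M.d (Sum.inl x₀) ∧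
      ImpulseControl.relaxedValue M.Q M.cost M.d (Sum.inl x₀) < ∞) ∧
    -- for every choice of `f*`
    ∀ f, ImpulseControl.IsSelector M.Q M.cost f →
      -- (b) there is an optimal strategy in `Π`, and restricted occupation measures of such
      -- strategies are optimal in the relaxed problem
      ((∃ π, ImpulseControl.InClassPi M.Q M.cost M.d (Sum.inl x₀) f π ∧
          ImpulseControl.Optimal M.Q M.cost M.d (Sum.inl x₀) π) ∧
        ∀ π, ImpulseControl.InClassPi M.Q M.cost M.d (Sum.inl x₀) f π →
          ImpulseControl.Optimal M.Q M.cost M.d (Sum.inl x₀) π →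
          ImpulseControl.RelaxedOptimal M.Q M.cost M.d (Sum.inl x₀)
            (ImpulseControl.restrictV M.Q M.cost
              (ImpulseControl.occupation M.Q (Sum.inl x₀) π))) ∧
      -- (c) an optimal measure induces a strategy, and each strategy it induces is in `Π` and optimal
      ∀ μ, ImpulseControl.RelaxedOptimal M.Q M.cost M.d (Sum.inl x₀) μ →
        (∃ s : ProbabilityTheory.Kernel (ImpulseControl.StateΔ X) (ImpulseControl.Action A),
          ProbabilityTheory.IsMarkovKernel s ∧ ImpulseControl.IsInduced M.Q M.cost f μ s) ∧
        ∀ (s : ProbabilityTheory.Kernel (ImpulseControl.StateΔ X) (ImpulseControl.Action A))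
          [ProbabilityTheory.IsMarkovKernel s],
          ImpulseControl.IsInduced M.Q M.cost f μ s →
            ImpulseControl.InClassPi M.Q M.cost M.d (Sum.inl x₀) f
              (ImpulseControl.Strategy.stationary s) ∧
            ImpulseControl.Optimal M.Q M.cost M.d (Sum.inl x₀)
              (ImpulseControl.Strategy.stationary s) := by
  have := ImpulseControl.borelSpace_sum X Unit
  have := ImpulseControl.metrizableSpace_sum X Unit
  have := ImpulseControl.standardBorelSpace_sum X Unit
  exact ImpulseControl.relaxation_of_semicontinuous hsemi hfeas
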